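/- Let $n,d\in\mathbb N$ with $0<d<n$. Let $\mathcal H^d$ be $d$-dimensional Hausdorff measure on $\mathbb R^n$, normalized so that $\mathcal H^d(P\cap B(x,r))=r^d$ for every $d$-plane $P$, $x\in P$, $r>0$, where $B(x,r)$ is the open ball. **Definitions.** A $d$-dimensional *Lipschitz graph* with constant $\le\delta$ is a set $\Gamma=\{v+f(v):v\in V\}$, where $V\subset\mathbb R^n$ is a $d$-dimensional linear subspace and $f:V\to V^\perp$ is Lipschitz with constant $\le\delta$. A closed set $E\subset\mathbb R^n$ is *$\delta$-UR of dimension $d$* if $0<\delta<1/10$ and for all $x\in E$, $r>0$ there is a $d$-dimensional Lipschitz graph $\Gamma$ with constant $\le\delta$ such that $\mathcal H^d(B(x,r)\cap(E\triangle\Gamma))\le\delta r^d$ and $\Gamma\cap B(x,r/2)\neq\emptyset$. A closed set $E$ is *$d$-Ahlfors regular* if for some $C_E>0$, $C_E^{-1}r^d\le\mathcal H^d(E\cap B(x,r))\le C_Er^d$ for all $x\in E$, $r>0$. A *system of dyadic cubes* for $E$ with constant $C\ge1$ consists of a partition $\Delta_j$ of $E$ for each $j\in\mathbb Z$ and a center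 $c_Q\in Q$ for each cube $Q$, such that - if $j\le k$, $Q\in\Delta_j$, $Q'\in\Delta_k$, then $Q\cap Q'=\emptyset$ or $Q\subset Q'$; - if $Q\in\Delta_j$, then $C^{-1}2^j\le\operatorname{diam}Q\le C2^j$ and $C^{-1}2^{jd}\le\mathcal H^d(Q)\le C2^{jd}$; - if $Q\in\Delta_j$ and $\tau>0$, then $\mathcal H^d(\{x\in Q:\operatorname{dist}(x,E\setminus Q)\le\tau2^j\})\le C\tau^{1/C}2^{jd}$; - $\operatorname{dist}(c_Q,E\setminus Q)\ge C^{-1}\operatorname{diam}Q$ for every cube $Q$. Put $\Delta=\bigcup_j\Delta_j$, where a cube $Q\in\Delta_j$ remembers its generation $\operatorname{gen}Q=j$. A cube $Q$ is contained in a cube $Q'$ if $\operatorname{gen}Q\le\operatorname{gen}Q'$ and $Q\subset Q'$ as sets, and it is a child of $Q'$ if moreover $\operatorname{gen}Q=\operatorname{gen}Q'-1$. Let $\Delta(R)$ be the set of cubes contained in $R$, and let $\lambda B_Q=B(c_Q,\lambda\operatorname{diam}Q)$. For $\varepsilon>0$, $E$ *admits an $\varepsilon$-Corona decomposition in $R_0\in\Delta$*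 if for each $R\in\Delta$ with $\operatorname{gen}R=\operatorname{gen}R_0$ and $R\subset\varepsilon^{-1}B_{R_0}$ there is a partition $\mathcal F(R)$ of $\Delta(R)$, and for each $S\in\mathcal F(R)$ a $d$-dimensional Lipschitz graph $\Gamma(S)$ with constant $\le\varepsilon$, such that 1. each $S\in\mathcal F(R)$ has a maximal cube $Q(S)\in S$ containing all cubes of $S$; if $Q\in S$, $Q'\in\Delta(R)$ and $Q\subset Q'\subset Q(S)$, then $Q'\in S$; and if $Q\in S$, then either all or none of the children of $Q$ belong to $S$; 2. for each $S\in\mathcal F(R)$, $\mathcal H^d(\varepsilon^{-1}B_{Q(S)}\cap(E\triangle\Gamma(S)))\le\varepsilon\,\mathcal H^d(Q(S))$, and for each $Q\in S$ and $x\in\varepsilon^{-1}B_Q\cap(E\cup\Gamma(S))$, $\operatorname{dist}(x,E)+\operatorname{dist}(x,\Gamma(S))\le\varepsilon\operatorname{diam}Q$; 3. for each $R'\in\Delta(R)$, $\displaystyle\sum_{S\in\mathcal F(R),\,Q(S)\subset R'}\mathcal H^d(Q(S))\le(1+\varepsilon)\,\mathcal H^d(R')$; 4. if $R\in S_R\in\mathcal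 F(R)$ and $R_0\in S_{R_0}\in\mathcal F(R_0)$, then $\Gamma(S_R)=\Gamma(S_{R_0})$. $E$ *admits $\varepsilon$-Corona decompositions* with respect to $\Delta$ if it admits one in every $R_0\in\Delta$. **Theorem.** There are constants $C_{n,d}>1$, $C_0\ge1$, $\delta_0>0$ and $\theta_0\in(0,1)$, depending only on $n$ and $d$, such that if $0<\delta<\delta_0$ and $E\subset\mathbb R^n$ is $\delta$-UR of dimension $d$, then $E$ is $d$-Ahlfors regular, $E$ has a system of dyadic cubes with constant at most $C_{n,d}$, and with respect to every system of dyadic cubes for $E$ with constant at most $C_{n,d}$, $E$ admits $C_0\delta^{\theta_0}$-Corona decompositions. -/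

import Mathlib

open MeasureTheory
open scoped ENNReal NNReal symmDiff

/-- `d`-dimensional Hausdorff measure on `ℝⁿ`, normalised so that a ball of radius `r` centred on
a `d`-plane meets that plane in a set of measure `r ^ d`. -/
noncomputable def normHausdorff (n d : ℕ) : Measure (EuclideanSpace ℝ (Fin n)) :=
  (Measure.hausdorffMeasure (d : ℝ) (Metric.ball (0 : EuclideanSpace ℝ (Fin d)) 1))⁻¹ •
    Measure.hausdorffMeasure (d : ℝ)

/-- `Γ` is a `d`-dimensional Lipschitz graph with constant `≤ δ`: the graph of a `K`-Lipschitz map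
`V → Vᗮ` with `K ≤ δ`, defined on a whole `d`-dimensional linear subspace `V` of `ℝⁿ`. -/
def IsLipschitzGraph {n : ℕ} (d : ℕ) (δ : ℝ) (Γ : Set (EuclideanSpace ℝ (Fin n))) : Prop :=
  ∃ V : Submodule ℝ (EuclideanSpace ℝ (Fin n)), Module.finrank ℝ V = d ∧
    ∃ (K : ℝ≥0) (f : V → Vᗮ), (K : ℝ) ≤ δ ∧ LipschitzWith K f ∧
      Γ = Set.range fun v : V =>
        (v : EuclideanSpace ℝ (Fin n)) + (f v : EuclideanSpace ℝ (Fin n))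

/-- `E` is `δ`-uniformly rectifiable (`δ`-UR) of dimension `d`. -/
def IsDeltaUR {n : ℕ} (d : ℕ) (δ : ℝ) (E : Set (EuclideanSpace ℝ (Fin n))) : Prop :=
  IsClosed E ∧ 0 < δ ∧ δ < 1 / 10 ∧
    ∀ x ∈ E, ∀ r : ℝ, 0 < r → ∃ Γ : Set (EuclideanSpace ℝ (Fin n)),
      IsLipschitzGraph d δ Γ ∧
      normHausdorff n d (Metric.ball x r ∩ (E ∆ Γ)) ≤ ENNReal.ofReal (δ * r ^ d) ∧
      (Γ ∩ Metric.ball x (r / 2)).Nonempty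

/-- `E` is closed and `d`-Ahlfors regular with constant `C`. -/
def IsAhlforsRegular {n : ℕ} (d : ℕ) (C : ℝ) (E : Set (EuclideanSpace ℝ (Fin n))) : Prop :=
  IsClosed E ∧ 0 < C ∧ ∀ x ∈ E, ∀ r : ℝ, 0 < r →
    ENNReal.ofReal (C⁻¹ * r ^ d) ≤ normHausdorff n d (E ∩ Metric.ball x r) ∧
    normHausdorff n d (E ∩ Metric.ball x r) ≤ ENNReal.ofReal (C * r ^ d)

/-- A (Christ-David) system of dyadic cubes for `E` with constant `C`. The sets in `cubes j` are
the cubes of generation `j`; `center Q` is the chosen centre `c_Q` of the cube `Q`. -/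
structure DyadicSystem {n : ℕ} (d : ℕ) (E : Set (EuclideanSpace ℝ (Fin n))) (C : ℝ) where
  cubes : ℤ → Set (Set (EuclideanSpace ℝ (Fin n)))
  center : Set (EuclideanSpace ℝ (Fin n)) → EuclideanSpace ℝ (Fin n)
  one_le : 1 ≤ C
  sUnion_eq : ∀ j, ⋃₀ cubes j = E
  pairwiseDisjoint : ∀ j, (cubes j).PairwiseDisjoint id
  nested : ∀ j k : ℤ, j ≤ k → ∀ Q ∈ cubes j, ∀ Q' ∈ cubes k, Disjoint Q Q' ∨ Q ⊆ Q'
  diam_bounds : ∀ j, ∀ Q ∈ cubes j,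
    C⁻¹ * (2 : ℝ) ^ j ≤ Metric.diam Q ∧ Metric.diam Q ≤ C * (2 : ℝ) ^ j
  measure_bounds : ∀ j, ∀ Q ∈ cubes j,
    ENNReal.ofReal (C⁻¹ * ((2 : ℝ) ^ j) ^ d) ≤ normHausdorff n d Q ∧
    normHausdorff n d Q ≤ ENNReal.ofReal (C * ((2 : ℝ) ^ j) ^ d)
  small_boundary : ∀ j, ∀ Q ∈ cubes j, ∀ τ : ℝ, 0 < τ →
    normHausdorff n d {x ∈ Q | Metric.infEDist x (E \ Q) ≤ ENNReal.ofReal (τ * (2 : ℝ) ^ j)} ≤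
      ENNReal.ofReal (C * τ ^ (1 / C) * ((2 : ℝ) ^ j) ^ d)
  center_mem : ∀ j, ∀ Q ∈ cubes j, center Q ∈ Q
  center_dist : ∀ j, ∀ Q ∈ cubes j,
    ENNReal.ofReal (C⁻¹ * Metric.diam Q) ≤ Metric.infEDist (center Q) (E \ Q)

namespace DyadicSystem

variable {n d : ℕ} {E : Set (EuclideanSpace ℝ (Fin n))} {C : ℝ}

/-- A dyadic cube of the system. A cube remembers its generation, so one set that occurs in two
generations gives two cubes. -/
structure Cube (Δ : DyadicSystem d E C) where
  gen : ℤ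
  carrier : Set (EuclideanSpace ℝ (Fin n))
  mem : carrier ∈ Δ.cubes gen

/-- `Q ≤ Q'`: the dyadic cube `Q` is contained in the dyadic cube `Q'`, i.e. `Q ∈ Δ(Q')`. -/
instance (Δ : DyadicSystem d E C) : LE Δ.Cube :=
  ⟨fun Q Q' => Q.gen ≤ Q'.gen ∧ Q.carrier ⊆ Q'.carrier⟩

/-- `Q` is a child of `Q'`. -/
def IsChild {Δ : DyadicSystem d E C} (Q Q' : Δ.Cube) : Prop :=
  Q.gen + 1 = Q'.gen ∧ Q.carrier ⊆ Q'.carrier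

/-- The dilated ball `l B_Q = B(c_Q, l diam Q)`. -/
def dilBall {Δ : DyadicSystem d E C} (l : ℝ) (Q : Δ.Cube) : Set (EuclideanSpace ℝ (Fin n)) :=
  Metric.ball (Δ.center Q.carrier) (l * Metric.diam Q.carrier)

/-- The family `F` is a partition of `Δ(R)` into coherent subfamilies `S` with maximal cubes
`top S` and approximating graphs `Γ S`, with the closeness and packing estimates of a
`δ`-Corona decomposition. -/
structure IsCoronaPartition (Δ : DyadicSystem d E C) (δ : ℝ) (R : Δ.Cube)
    (F : Set (Set Δ.Cube)) (top : Set Δ.Cube → Δ.Cube)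
    (Γ : Set Δ.Cube → Set (EuclideanSpace ℝ (Fin n))) : Prop where
  sUnion_eq : ⋃₀ F = {Q | Q ≤ R}
  pairwiseDisjoint : F.PairwiseDisjoint id
  top_isGreatest : ∀ S ∈ F, IsGreatest S (top S)
  coherent : ∀ S ∈ F, ∀ Q ∈ S, ∀ Q' : Δ.Cube, Q' ≤ R → Q ≤ Q' → Q' ≤ top S → Q' ∈ S
  children : ∀ S ∈ F, ∀ Q ∈ S,
    (∀ Q' : Δ.Cube, IsChild Q' Q → Q' ∈ S) ∨ (∀ Q' : Δ.Cube, IsChild Q' Q → Q' ∉ S)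
  graph : ∀ S ∈ F, IsLipschitzGraph d δ (Γ S)
  graph_measure : ∀ S ∈ F,
    normHausdorff n d (dilBall δ⁻¹ (top S) ∩ (E ∆ Γ S)) ≤
      ENNReal.ofReal δ * normHausdorff n d (top S).carrier
  graph_dist : ∀ S ∈ F, ∀ Q ∈ S, ∀ x ∈ dilBall δ⁻¹ Q ∩ (E ∪ Γ S),
    Metric.infDist x E + Metric.infDist x (Γ S) ≤ δ * Metric.diam Q.carrier
  packing : ∀ R' : Δ.Cube, R' ≤ R →
    ∑' S : {S : Set Δ.Cube // S ∈ F ∧ top S ≤ R'}, normHausdorff n d (top S.1).carrier ≤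
      ENNReal.ofReal (1 + δ) * normHausdorff n d R'.carrier

/-- `E` admits a `δ`-Corona decomposition in the cube `R₀`: all the cubes `R` of the generation of
`R₀` inside `δ⁻¹ B_{R₀}` carry families `F R` as above, and the graph of the member of `F R` that
contains `R` is the same for all these `R`. -/
def AdmitsCoronaIn (Δ : DyadicSystem d E C) (δ : ℝ) (R₀ : Δ.Cube) : Prop :=
  ∃ (F : Δ.Cube → Set (Set Δ.Cube)) (top : Set Δ.Cube → Δ.Cube)
    (Γ : Set Δ.Cube → Set (EuclideanSpace ℝ (Fin n))),
    ∀ R : Δ.Cube, R.gen = R₀.gen → R.carrier ⊆ dilBall δ⁻¹ R₀ →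
      Δ.IsCoronaPartition δ R (F R) top Γ ∧
      ∀ S ∈ F R, R ∈ S → ∀ S₀ ∈ F R₀, R₀ ∈ S₀ → Γ S = Γ S₀

/-- `E` admits `δ`-Corona decompositions, with respect to the dyadic system `Δ`. -/
def AdmitsCorona (Δ : DyadicSystem d E C) (δ : ℝ) : Prop :=
  ∀ R₀ : Δ.Cube, Δ.AdmitsCoronaIn δ R₀

end DyadicSystem

/-!
Three facts carry the theorem.

*Ahlfors regularity* (`IsDeltaUR.isAhlforsRegular`). A Lipschitz graph is a bi-Lipschitz image of
`ℝᵈ`, so it is Ahlfors regular, and a set that differs from such graphs by `δ r ^ d` in every ball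
of radius `r` is Ahlfors regular too when `δ` is small; the constant `8 ^ d` depends on `d` only.

*Dyadic cubes* (`exists_dyadicSystem`). In any Ahlfors regular set, choose maximal nets at the
scales `256 ^ k`, and send every net point to a nearest point of the next coarser net. Each point
`x` of the set lies within `2 * 256 ^ k` of the net points of a coherent chain
(`nonempty_dyadicChains`), and the points whose chains agree at the scale `256 ^ k` form a cube. A
point close to the complement of its cube must, at each coarser scale, stay away from the centre of
the subcube it belongs to, since the neighbourhood of the centre is contained in the subcube. Each
such condition removes a fixed proportion of the remaining measure, which gives the power decay of
the boundary layers (`DyadicChains.exists_boundary_exponent`).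

*Corona decompositions* (`DyadicSystem.admitsCorona_of_isDeltaUR`). Give each cube `T` a Lipschitz
graph that approximates `E` at the scale `≈ ε⁻¹ diam T`, and stop below `T` at the first cubes that
have a sibling near which `E` and the graph are not `ε diam`-close. By Ahlfors regularity of both
sets, near such a cube their symmetric difference has measure `≳ (ε diam) ^ d`. The total measure of
the symmetric difference is at most `≈ δ (ε⁻¹ diam T) ^ d`, so by the Vitali covering lemma the
stopped cubes have total measure `≲ δ ε ^ (-3 * d)` times that of `T`
(`DyadicSystem.IsApproxGraph.tsum_measure_le`). This is at most `ε / 2` times the measure of `T` if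
`ε` is a large multiple of `δ ^ (1 / (3 * d + 1))`, and the packing estimate follows by summing a
geometric series (`DyadicSystem.tsum_tops_le`). The cubes of an arbitrary system need not be Borel,
but the small boundary condition makes them null measurable, which is what the summation needs.
-/

/-! ### Lipschitz graphs and Ahlfors regularity -/

section LipschitzGraph

variable {n d : ℕ}

/-- The normalisation of `normHausdorff` is by a positive finite number, so that in `ℝᵈ` the balls
of radius `r` have measure `r ^ d`. -/
lemma inv_hausdorffMeasure_mul_ball (x : EuclideanSpace ℝ (Fin d)) {r : ℝ} (hr : 0 < r) :
    (Measure.hausdorffMeasure (d : ℝ) (Metric.ball (0 : EuclideanSpace ℝ (Fin d)) 1))⁻¹ *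
      Measure.hausdorffMeasure (d : ℝ) (Metric.ball x r) = ENNReal.ofReal (r ^ d) := by
  have inst : (Measure.hausdorffMeasure (d : ℝ) :
      Measure (EuclideanSpace ℝ (Fin d))).IsAddHaarMeasure := by
    simpa using isAddHaarMeasure_hausdorffMeasure (E := EuclideanSpace ℝ (Fin d))
  rw [Measure.addHaar_ball_of_pos _ _ hr, finrank_euclideanSpace, Fintype.card_fin,
    mul_left_comm, ENNReal.inv_mul_cancel, mul_one]
  · exact (Metric.measure_ball_pos _ _ one_pos).ne'
  · exact measure_ball_lt_top.ne

/-- A Lipschitz graph of constant at most one is a bi-Lipschitz image of `ℝᵈ`. -/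
lemma IsLipschitzGraph.exists_param {δ : ℝ} (hδ : δ ≤ 1) {Γ : Set (EuclideanSpace ℝ (Fin n))}
    (h : IsLipschitzGraph d δ Γ) :
    ∃ g : EuclideanSpace ℝ (Fin d) → EuclideanSpace ℝ (Fin n),
      LipschitzWith 2 g ∧ AntilipschitzWith 1 g ∧ Γ = Set.range g := by
  obtain ⟨V, hV, K, f, hK, hf, rfl⟩ := h
  have hK1 : K ≤ 1 := by exact_mod_cast hK.trans hδ
  let e : EuclideanSpace ℝ (Fin d) ≃ₗᵢ[ℝ] V :=
    ((stdOrthonormalBasis ℝ V).reindex (finCongr hV)).repr.symm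
  refine ⟨fun u => (e u : EuclideanSpace ℝ (Fin n)) + (f (e u) : EuclideanSpace ℝ (Fin n)),
    ?_, ?_, ?_⟩
  · refine LipschitzWith.of_dist_le_mul fun u v => ?_
    have h1 := hf.dist_le_mul (e u) (e v)
    have h2 : dist ((f (e u) : Vᗮ) : EuclideanSpace ℝ (Fin n)) (f (e v)) ≤ dist u v := by
      rw [← Subtype.dist_eq]
      rw [e.dist_map] at h1
      refine h1.trans ?_
      have : (K : ℝ) ≤ 1 := by exact_mod_cast hK1
      nlinarith [dist_nonneg (x := u) (y := v)]
    have h3 : dist ((e u : V) : EuclideanSpace ℝ (Fin n)) (e v) = dist u v := by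
      rw [← Subtype.dist_eq, e.dist_map]
    refine (dist_add_add_le _ _ _ _).trans ?_
    rw [h3]
    simp only [NNReal.coe_ofNat]
    linarith
  · refine AntilipschitzWith.of_le_mul_dist fun u v => ?_
    have h3 : dist ((e u : V) : EuclideanSpace ℝ (Fin n)) (e v) = dist u v := by
      rw [← Subtype.dist_eq, e.dist_map]
    rw [← h3, NNReal.coe_one, one_mul, dist_eq_norm, dist_eq_norm]
    have hv : ((e u : V) : EuclideanSpace ℝ (Fin n)) - (e v : V) ∈ V :=
      V.sub_mem (e u).2 (e v).2
    have hw : ((f (e u) : Vᗮ) : EuclideanSpace ℝ (Fin n)) - (f (e v) : Vᗮ) ∈ Vᗮ :=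
      Vᗮ.sub_mem (f (e u)).2 (f (e v)).2
    have horth := Submodule.inner_right_of_mem_orthogonal hv hw
    have hp := norm_add_sq_eq_norm_sq_add_norm_sq_of_inner_eq_zero _ _ horth
    rw [add_sub_add_comm]
    nlinarith [norm_nonneg (((e u : V) : EuclideanSpace ℝ (Fin n)) - (e v : V)),
      norm_nonneg (((e u : V) : EuclideanSpace ℝ (Fin n)) - (e v : V) +
        (((f (e u) : Vᗮ) : EuclideanSpace ℝ (Fin n)) - (f (e v) : Vᗮ))),
      mul_self_nonneg ‖((f (e u) : Vᗮ) : EuclideanSpace ℝ (Fin n)) - (f (e v) : Vᗮ)‖]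
  · ext x
    constructor
    · rintro ⟨v, rfl⟩
      exact ⟨e.symm v, by simp⟩
    · rintro ⟨u, rfl⟩
      exact ⟨e u, rfl⟩

lemma IsLipschitzGraph.mono {δ δ' : ℝ} (h : δ ≤ δ') {Γ : Set (EuclideanSpace ℝ (Fin n))}
    (hΓ : IsLipschitzGraph d δ Γ) : IsLipschitzGraph d δ' Γ := by
  obtain ⟨V, hV, K, f, hK, hf⟩ := hΓ
  exact ⟨V, hV, K, f, hK.trans h, hf⟩

lemma IsLipschitzGraph.isClosed {δ : ℝ} (hδ : δ ≤ 1) {Γ : Set (EuclideanSpace ℝ (Fin n))}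
    (hΓ : IsLipschitzGraph d δ Γ) : IsClosed Γ := by
  obtain ⟨g, hg, hg', rfl⟩ := hΓ.exists_param hδ
  exact hg'.isClosed_range hg.uniformContinuous

lemma IsLipschitzGraph.measure_inter_ball_le {δ : ℝ} (hδ : δ ≤ 1)
    {Γ : Set (EuclideanSpace ℝ (Fin n))} (hΓ : IsLipschitzGraph d δ Γ)
    (x : EuclideanSpace ℝ (Fin n)) {r : ℝ} (hr : 0 < r) :
    normHausdorff n d (Γ ∩ Metric.ball x r) ≤ ENNReal.ofReal (4 ^ d * r ^ d) := by
  obtain ⟨g, hg, hg', rfl⟩ := hΓ.exists_param hδ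
  rcases (Set.range g ∩ Metric.ball x r).eq_empty_or_nonempty with h | ⟨_, ⟨u₀, rfl⟩, hu₀⟩
  · simp [h]
  have hsub : Set.range g ∩ Metric.ball x r ⊆ g '' Metric.ball u₀ (2 * r) := by
    rintro _ ⟨⟨u, rfl⟩, hu⟩
    refine ⟨u, ?_, rfl⟩
    have h1 := hg'.le_mul_dist u u₀
    rw [NNReal.coe_one, one_mul] at h1
    rw [Metric.mem_ball] at *
    have := dist_triangle_right (g u) (g u₀) x
    linarith
  calc normHausdorff n d (Set.range g ∩ Metric.ball x r)
      ≤ normHausdorff n d (g '' Metric.ball u₀ (2 * r)) := measure_mono hsub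
    _ ≤ (Measure.hausdorffMeasure (d : ℝ) (Metric.ball (0 : EuclideanSpace ℝ (Fin d)) 1))⁻¹ *
        ((2 : ℝ≥0∞) ^ d * Measure.hausdorffMeasure (d : ℝ) (Metric.ball u₀ (2 * r))) := by
        rw [normHausdorff, Measure.smul_apply, smul_eq_mul]
        gcongr
        have := hg.hausdorffMeasure_image_le (Nat.cast_nonneg d) (Metric.ball u₀ (2 * r))
        simpa using this
    _ = ENNReal.ofReal (4 ^ d * r ^ d) := by
        rw [mul_left_comm, inv_hausdorffMeasure_mul_ball u₀ (by positivity)]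
        rw [show (2 : ℝ≥0∞) ^ d = ENNReal.ofReal (2 ^ d) by
          rw [ENNReal.ofReal_pow (by norm_num)]; norm_num]
        rw [← ENNReal.ofReal_mul (by positivity), ← mul_pow, ← mul_pow]
        congr 2
        ring

lemma IsLipschitzGraph.le_measure_inter_ball {δ : ℝ} (hδ : δ ≤ 1)
    {Γ : Set (EuclideanSpace ℝ (Fin n))} (hΓ : IsLipschitzGraph d δ Γ)
    {y : EuclideanSpace ℝ (Fin n)} (hy : y ∈ Γ) {r : ℝ} (hr : 0 < r) :
    ENNReal.ofReal ((r / 2) ^ d) ≤ normHausdorff n d (Γ ∩ Metric.ball y r) := by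
  obtain ⟨g, hg, hg', rfl⟩ := hΓ.exists_param hδ
  obtain ⟨u, rfl⟩ := hy
  have hsub : g '' Metric.ball u (r / 2) ⊆ Set.range g ∩ Metric.ball (g u) r := by
    rintro _ ⟨v, hv, rfl⟩
    refine ⟨⟨v, rfl⟩, ?_⟩
    have h1 := hg.dist_le_mul v u
    rw [Metric.mem_ball] at *
    simp only [NNReal.coe_ofNat] at h1
    linarith
  refine le_trans ?_ (measure_mono hsub)
  rw [normHausdorff, Measure.smul_apply, smul_eq_mul,
    ← inv_hausdorffMeasure_mul_ball u (half_pos hr)]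
  gcongr
  have := hg'.le_hausdorffMeasure_image (Nat.cast_nonneg d) (Metric.ball u (r / 2))
  simpa using this

/-- Where a ball is almost filled by a Lipschitz graph passing near its centre, the measure of `E`
is comparable to that of the graph. -/
lemma IsDeltaUR.isAhlforsRegular (hd : 0 < d) {δ : ℝ} {E : Set (EuclideanSpace ℝ (Fin n))}
    (hE : IsDeltaUR d δ E) (hδ : δ ≤ (1 / 8) ^ d) : IsAhlforsRegular d (8 ^ d) E := by
  obtain ⟨hcl, hδ0, hδ1, h⟩ := hE
  have hone : δ ≤ 1 := by linarith
  refine ⟨hcl, by positivity, fun x hx r hr => ?_⟩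
  obtain ⟨Γ, hΓ, hm, y, hyΓ, hy⟩ := h x hx r hr
  have h24 : (2 : ℝ) * (1 / 8) ^ d ≤ (1 / 4) ^ d := by
    have h2 : (2 : ℝ) ≤ 2 ^ d := le_self_pow₀ (by norm_num) hd.ne'
    calc (2 : ℝ) * (1 / 8) ^ d ≤ 2 ^ d * (1 / 8) ^ d := by gcongr
      _ = (1 / 4) ^ d := by rw [← mul_pow]; norm_num
  constructor
  · have h1 := hΓ.le_measure_inter_ball hone hyΓ (half_pos hr)
    have h2 : Γ ∩ Metric.ball y (r / 2) ⊆
        (E ∩ Metric.ball x r) ∪ (Metric.ball x r ∩ (E ∆ Γ)) := by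
      rintro z ⟨hz, hz'⟩
      have hzx : z ∈ Metric.ball x r := by
        rw [Metric.mem_ball] at *
        linarith [dist_triangle z y x]
      by_cases hzE : z ∈ E
      · exact Or.inl ⟨hzE, hzx⟩
      · exact Or.inr ⟨hzx, Or.inr ⟨hz, hzE⟩⟩
    have h3 := h1.trans ((measure_mono h2).trans (measure_union_le _ _))
    have h4 : ENNReal.ofReal ((r / 2 / 2) ^ d) ≤
        normHausdorff n d (E ∩ Metric.ball x r) + ENNReal.ofReal (δ * r ^ d) := by
      refine h3.trans ?_
      gcongr
    refine le_trans ?_ (tsub_le_iff_right.2 h4)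
    rw [← ENNReal.ofReal_sub _ (by positivity)]
    refine ENNReal.ofReal_le_ofReal ?_
    have h5 : (r / 2 / 2) ^ d = (1 / 4) ^ d * r ^ d := by rw [← mul_pow]; congr 1; ring
    have h6 : ((8 : ℝ) ^ d)⁻¹ = (1 / 8) ^ d := by rw [one_div, inv_pow]
    have hrd : 0 < r ^ d := by positivity
    rw [h5, h6, ← sub_mul]
    gcongr
    linarith
  · have h2 : E ∩ Metric.ball x r ⊆
        (Γ ∩ Metric.ball x r) ∪ (Metric.ball x r ∩ (E ∆ Γ)) := by
      rintro z ⟨hz, hz'⟩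
      by_cases hzE : z ∈ Γ
      · exact Or.inl ⟨hzE, hz'⟩
      · exact Or.inr ⟨hz', Or.inl ⟨hz, hzE⟩⟩
    refine (measure_mono h2).trans ((measure_union_le _ _).trans ?_)
    refine (add_le_add (hΓ.measure_inter_ball_le hone x hr) hm).trans ?_
    rw [← ENNReal.ofReal_add (by positivity) (by positivity)]
    refine ENNReal.ofReal_le_ofReal ?_
    rw [← add_mul]
    gcongr
    have h2 : (2 : ℝ) ≤ 2 ^ d := le_self_pow₀ (by norm_num) hd.ne'
    have h4 : (1 : ℝ) ≤ 4 ^ d := one_le_pow₀ (by norm_num)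
    calc (4 : ℝ) ^ d + δ ≤ 2 * 4 ^ d := by linarith
      _ ≤ 2 ^ d * 4 ^ d := by gcongr
      _ = 8 ^ d := by rw [← mul_pow]; norm_num

end LipschitzGraph

/-! ### Coherent chains of net points -/

section Chains

variable {X : Type*} [MetricSpace X]

/-- A choice, for each point `x` of `E` and each scale `256 ^ k`, of a point `pt k x` of `E` at
distance `≲ 256 ^ k` from `x`, such that the level sets of `pt k` are unions of level sets of
`pt j` for `j ≤ k`, and each of them contains the points of `E` near its value. The level sets are
the cubes of side `256 ^ k`. -/
structure DyadicChains (E : Set X) where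
  pt : ℤ → X → X
  pt_mem : ∀ k, ∀ x ∈ E, pt k x ∈ E
  pt_succ : ∀ k, ∀ x ∈ E, ∀ y ∈ E, pt k x = pt k y → pt (k + 1) x = pt (k + 1) y
  dist_le : ∀ k, ∀ x ∈ E, dist x (pt k x) ≤ 2 * 256 ^ k
  pt_eq : ∀ k, ∀ x ∈ E, ∀ y ∈ E, dist y (pt k x) < 256 ^ k / 8 → pt k y = pt k x

lemma exists_separated_net (E : Set X) {r : ℝ} (hr : 0 < r) :
    ∃ N ⊆ E, (∀ x ∈ N, ∀ y ∈ N, dist x y < r → x = y) ∧ ∀ x ∈ E, ∃ z ∈ N, dist x z < r := by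
  obtain ⟨N, hN⟩ := zorn_subset
    {N : Set X | N ⊆ E ∧ ∀ x ∈ N, ∀ y ∈ N, dist x y < r → x = y} (by
      intro c hc hchain
      refine ⟨⋃₀ c, ⟨Set.sUnion_subset fun s hs => (hc hs).1, ?_⟩,
        fun s hs => Set.subset_sUnion_of_mem hs⟩
      rintro x ⟨s, hs, hx⟩ y ⟨t, ht, hy⟩ hxy
      rcases hchain.total hs ht with h | h
      · exact (hc ht).2 x (h hx) y hy hxy
      · exact (hc hs).2 x hx y (h hy) hxy)
  refine ⟨N, hN.prop.1, hN.prop.2, fun x hx => ?_⟩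
  by_contra! hfar
  have hins : insert x N ∈ {N : Set X | N ⊆ E ∧ ∀ x ∈ N, ∀ y ∈ N, dist x y < r → x = y} := by
    refine ⟨Set.insert_subset hx hN.prop.1, ?_⟩
    rintro y (rfl | hy) z (rfl | hz) hyz
    · rfl
    · exact absurd hyz (hfar z hz).not_gt
    · exact absurd (dist_comm y z ▸ hyz) (hfar y hy).not_gt
    · exact hN.prop.2 y hy z hz hyz
  have hxN : x ∈ N := hN.le_of_ge hins (Set.subset_insert x N) (Set.mem_insert x N)
  have := hfar x hxN
  rw [dist_self] at this
  linarith

lemma finite_inter_closedBall_of_separated [ProperSpace X] {N : Set X} {r : ℝ} (hr : 0 < r)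
    (hN : ∀ x ∈ N, ∀ y ∈ N, dist x y < r → x = y) (x : X) (R : ℝ) :
    (N ∩ Metric.closedBall x R).Finite := by
  by_contra hinf
  obtain ⟨t, -, htc, hcov⟩ := (isCompact_closedBall x R).elim_finite_subcover_image
    (b := Set.univ) (c := fun y => Metric.ball y (r / 2)) (fun _ _ => Metric.isOpen_ball)
    (fun y _ => Set.mem_biUnion (Set.mem_univ y) (Metric.mem_ball_self (half_pos hr)))
  choose! f hf using fun y (hy : y ∈ N ∩ Metric.closedBall x R) =>
    Set.mem_iUnion₂.1 (hcov hy.2)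
  refine hinf (Set.Finite.of_finite_image (f := f) (htc.subset ?_) ?_)
  · rintro _ ⟨y, hy, rfl⟩
    exact (hf y hy).1
  · intro y hy z hz hyz
    have h1 := (hf y hy).2
    have h2 := (hf z hz).2
    rw [← show f y = f z from hyz] at h2
    rw [Metric.mem_ball] at h1 h2
    exact hN y hy.1 z hz.1 (by linarith [dist_triangle_right y z (f y)])

/-- The points `pt k x` come from maximal nets with a parent map towards the next coarser net. The
ancestors of finer and finer approximations of `x` stay, at each scale, in a finite set, and their
limit along an ultrafilter is a chain for the parent map. -/
theorem nonempty_dyadicChains [ProperSpace X] (E : Set X) : Nonempty (DyadicChains E) := by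
  have hpos : ∀ k : ℤ, (0 : ℝ) < 256 ^ k := fun k => by positivity
  have hsucc : ∀ k : ℤ, (256 : ℝ) ^ (k + 1) = 256 * 256 ^ k := fun k => by
    rw [zpow_add_one₀ (by norm_num), mul_comm]
  choose N hNE hsep hnet using fun k : ℤ => exists_separated_net E (hpos k)
  have hparent : ∀ k : ℤ, ∀ z : X, ∃ w, z ∈ E → w ∈ N (k + 1) ∧ dist z w < 256 ^ (k + 1) ∧
      ∀ v ∈ N (k + 1), dist z v < 256 ^ (k + 1) / 2 → w = v := by
    intro k z
    by_cases hz : z ∈ E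
    · by_cases hv : ∃ v ∈ N (k + 1), dist z v < 256 ^ (k + 1) / 2
      · obtain ⟨v, hv, hzv⟩ := hv
        refine ⟨v, fun _ => ⟨hv, by linarith [hpos (k + 1)], fun u hu hzu => ?_⟩⟩
        exact hsep _ v hv u hu (by linarith [dist_triangle_left v u z])
      · obtain ⟨w, hw, hzw⟩ := hnet (k + 1) z hz
        exact ⟨w, fun _ => ⟨hw, hzw, fun v hv' hzv => absurd ⟨v, hv', hzv⟩ hv⟩⟩
    · exact ⟨z, fun h => absurd h hz⟩
  choose p hp using hparent
  have hchain : ∀ x : X, ∃ c : ℤ → X, x ∈ E → ∀ k, c k ∈ N k ∧ dist x (c k) ≤ 2 * 256 ^ k ∧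
      c (k + 1) = p k (c k) := by
    intro x
    by_cases hx : x ∈ E
    swap
    · exact ⟨fun _ => x, fun h => absurd h hx⟩
    choose q hqN hq using fun m : ℕ => hnet (-(m : ℤ)) x hx
    let a : ℕ → ℕ → X := fun m j => Nat.rec (q m) (fun j y => p (-(m : ℤ) + j) y) j
    have ha : ∀ m j : ℕ, a m j ∈ N (-(m : ℤ) + j) ∧
        dist x (a m j) ≤ 2 * 256 ^ (-(m : ℤ) + j) := by
      intro m j
      induction j with
      | zero =>
        have h0 : -(m : ℤ) + ((0 : ℕ) : ℤ) = -(m : ℤ) := by simp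
        rw [h0]
        exact ⟨hqN m, (hq m).le.trans (by linarith [hpos (-(m : ℤ))])⟩
      | succ j ih =>
        have h0 : -(m : ℤ) + ((j + 1 : ℕ) : ℤ) = -(m : ℤ) + j + 1 := by push_cast; ring
        rw [h0]
        have h1 := hp (-(m : ℤ) + j) (a m j) (hNE _ ih.1)
        refine ⟨h1.1, (dist_triangle x (a m j) _).trans ?_⟩
        have h2 : dist (a m j) (a m (j + 1)) < 256 ^ (-(m : ℤ) + j + 1) := h1.2.1
        have h3 := hsucc (-(m : ℤ) + j)
        have h4 := hpos (-(m : ℤ) + j)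
        linarith [ih.2]
    let b : ℕ → ℤ → X := fun m k => a m (k + m).toNat
    have hb : ∀ (m : ℕ) (k : ℤ), -(m : ℤ) ≤ k → b m k ∈ N k ∧ dist x (b m k) ≤ 2 * 256 ^ k ∧
        b m (k + 1) = p k (b m k) := by
      intro m k hk
      have h1 := ha m (k + m).toNat
      have h2 : -(m : ℤ) + ((k + m).toNat : ℤ) = k := by omega
      have h3 : (k + 1 + m).toNat = (k + m).toNat + 1 := by omega
      rw [h2] at h1
      refine ⟨h1.1, h1.2, ?_⟩
      change a m (k + 1 + m).toNat = p k (a m (k + m).toNat)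
      rw [h3]
      change p (-(m : ℤ) + (k + m).toNat) _ = _
      rw [h2]
    let U : Ultrafilter ℕ := Filter.hyperfilter ℕ
    have hev : ∀ k : ℤ, ∀ᶠ m : ℕ in (U : Filter ℕ), -(m : ℤ) ≤ k := by
      intro k
      refine Filter.Eventually.filter_mono Nat.hyperfilter_le_atTop ?_
      filter_upwards [Filter.eventually_ge_atTop k.natAbs] with m hm
      omega
    have hlim : ∀ k : ℤ, ∃ z, ∀ᶠ m in (U : Filter ℕ), b m k = z := by
      intro k
      have hfin := finite_inter_closedBall_of_separated (hpos k) (hsep k) x (2 * 256 ^ k)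
      have hmem : (⋃ z ∈ N k ∩ Metric.closedBall x (2 * 256 ^ k), {m | b m k = z}) ∈ U := by
        filter_upwards [hev k] with m hm
        have h := hb m k hm
        exact Set.mem_biUnion (x := b m k)
          ⟨h.1, by rw [Metric.mem_closedBall, dist_comm]; exact h.2.1⟩ rfl
      obtain ⟨z, -, hz⟩ := (Ultrafilter.finite_biUnion_mem_iff hfin).1 hmem
      exact ⟨z, hz⟩
    choose c hc using hlim
    refine ⟨c, fun _ k => ?_⟩
    obtain ⟨m, h1, h2, h3⟩ := ((hc k).and ((hc (k + 1)).and (hev k))).exists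
    have h := hb m k h3
    rw [h1, h2] at h
    exact h
  choose c hc using hchain
  refine ⟨⟨fun k x => c x k, fun k x hx => hNE k (hc x hx k).1, fun k x hx y hy hxy => ?_,
    fun k x hx => (hc x hx k).2.1, fun k x hx y hy hxy => ?_⟩⟩
  · rw [(hc x hx k).2.2, (hc y hy k).2.2]
    exact congrArg (p k) hxy
  · -- the chain of `y` passes close to the net point `c x k` one scale below
    obtain ⟨k, rfl⟩ : ∃ j, k = j + 1 := ⟨k - 1, by ring⟩
    have h1 := hc y hy k
    change c y (k + 1) = c x (k + 1)
    rw [h1.2.2]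
    refine (hp k (c y k) (hNE _ h1.1)).2.2 _ (hc x hx (k + 1)).1 ?_
    have h2 := dist_triangle_left (c y k) (c x (k + 1)) y
    have h3 := hsucc k
    have h4 := hpos k
    linarith [h1.2.1]

namespace DyadicChains

variable {E : Set X} (s : DyadicChains E)

/-- The cube of side `256 ^ k` that contains `x`. -/
def cube (k : ℤ) (x : X) : Set X := {y ∈ E | s.pt k y = s.pt k x}

lemma pt_mono {j k : ℤ} (hjk : j ≤ k) {x y : X} (hx : x ∈ E) (hy : y ∈ E)
    (h : s.pt j x = s.pt j y) : s.pt k x = s.pt k y := by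
  induction k, hjk using Int.leInduction with
  | base => exact h
  | succ k _ ih => exact s.pt_succ k x hx y hy ih

lemma pt_pt (k : ℤ) {x : X} (hx : x ∈ E) : s.pt k (s.pt k x) = s.pt k x :=
  s.pt_eq k x hx _ (s.pt_mem k x hx) (by rw [dist_self]; positivity)

lemma pt_mem_cube (k : ℤ) {x : X} (hx : x ∈ E) : s.pt k x ∈ s.cube k x :=
  ⟨s.pt_mem k x hx, s.pt_pt k hx⟩

lemma inter_ball_subset_cube (k : ℤ) {x : X} (hx : x ∈ E) :
    E ∩ Metric.ball (s.pt k x) (256 ^ k / 8) ⊆ s.cube k x :=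
  fun y hy => ⟨hy.1, s.pt_eq k x hx y hy.1 hy.2⟩

lemma cube_subset_closedBall (k : ℤ) (x : X) :
    s.cube k x ⊆ Metric.closedBall (s.pt k x) (2 * 256 ^ k) := by
  rintro y ⟨hy, hyx⟩
  rw [Metric.mem_closedBall, ← hyx]
  exact s.dist_le k y hy

lemma cube_subset_inter_ball (k : ℤ) (x : X) :
    s.cube k x ⊆ E ∩ Metric.ball (s.pt k x) (3 * 256 ^ k) := by
  intro y hy
  refine ⟨hy.1, Metric.closedBall_subset_ball ?_ (s.cube_subset_closedBall k x hy)⟩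
  have : (0 : ℝ) < 256 ^ k := by positivity
  linarith

lemma diam_cube_le (k : ℤ) (x : X) : Metric.diam (s.cube k x) ≤ 4 * 256 ^ k := by
  have h0 : (0 : ℝ) ≤ 2 * 256 ^ k := by positivity
  refine (Metric.diam_mono (s.cube_subset_closedBall k x) Metric.isBounded_closedBall).trans
    ((Metric.diam_closedBall h0).trans (by linarith))

lemma isBounded_cube (k : ℤ) (x : X) : Bornology.IsBounded (s.cube k x) :=
  Metric.isBounded_closedBall.subset (s.cube_subset_closedBall k x)

lemma finite_image_pt [ProperSpace X] (k : ℤ) {U : Set X} (hUE : U ⊆ E)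
    (hU : Bornology.IsBounded U) : (s.pt k '' U).Finite := by
  rcases U.eq_empty_or_nonempty with rfl | ⟨x₀, -⟩
  · simp
  obtain ⟨R, hR⟩ := hU.subset_closedBall x₀
  refine (finite_inter_closedBall_of_separated (N := s.pt k '' E) (r := 256 ^ k / 8)
    (by positivity) ?_ x₀ (R + 2 * 256 ^ k)).subset ?_
  · rintro _ ⟨x, hx, rfl⟩ _ ⟨y, hy, rfl⟩ h
    rw [← s.pt_pt k hx]
    exact s.pt_eq k y hy _ (s.pt_mem k x hx) h
  · rintro _ ⟨x, hx, rfl⟩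
    refine ⟨⟨x, hUE hx, rfl⟩, ?_⟩
    have h1 := s.dist_le k x (hUE hx)
    have h2 := hR hx
    rw [Metric.mem_closedBall] at *
    linarith [dist_triangle_left (s.pt k x) x₀ x]

end DyadicChains

end Chains

/-! ### Christ–David cubes in Ahlfors regular sets -/

namespace DyadicChains

variable {n d : ℕ} {a : ℝ} {E : Set (EuclideanSpace ℝ (Fin n))} (s : DyadicChains E)

lemma measure_cube_le (hE : IsAhlforsRegular d a E) (k : ℤ) {x : EuclideanSpace ℝ (Fin n)}
    (hx : x ∈ E) : normHausdorff n d (s.cube k x) ≤ ENNReal.ofReal (a * (3 * 256 ^ k) ^ d) :=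
  (measure_mono (s.cube_subset_inter_ball k x)).trans
    (hE.2.2 _ (s.pt_mem k x hx) _ (by positivity)).2

lemma le_measure_cube (hE : IsAhlforsRegular d a E) (k : ℤ) {x : EuclideanSpace ℝ (Fin n)}
    (hx : x ∈ E) :
    ENNReal.ofReal (a⁻¹ * (256 ^ k / 8) ^ d) ≤ normHausdorff n d (s.cube k x) :=
  (hE.2.2 _ (s.pt_mem k x hx) _ (by positivity)).1.trans
    (measure_mono (s.inter_ball_subset_cube k hx))

/-- A cube has measure `≳ (256 ^ k) ^ d`, hence it does not fit into a ball much smaller than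
`256 ^ k`. -/
lemma le_diam_cube (hd : 0 < d) (ha : 1 ≤ a) (hE : IsAhlforsRegular d a E) (k : ℤ)
    {x : EuclideanSpace ℝ (Fin n)} (hx : x ∈ E) :
    (16 * a ^ 2)⁻¹ * 256 ^ k ≤ Metric.diam (s.cube k x) := by
  by_contra! hlt
  have hl : (0 : ℝ) < 256 ^ k := by positivity
  -- a ball of radius `t * 256 ^ k / 8` has measure at most half of the lower bound for the cube
  set t : ℝ := (2 * a ^ 2)⁻¹ with ht
  have ht0 : 0 < t := by positivity
  have ht1 : t ≤ 1 := inv_le_one_of_one_le₀ (by nlinarith)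
  have hlt' : Metric.diam (s.cube k x) < t * (256 ^ k / 8) := by
    refine hlt.trans_eq ?_
    rw [ht, show (16 : ℝ) * a ^ 2 = 8 * (2 * a ^ 2) by ring, mul_inv]
    ring
  have hsub : s.cube k x ⊆ E ∩ Metric.ball (s.pt k x) (t * (256 ^ k / 8)) := fun y hy =>
    ⟨hy.1, (Metric.dist_le_diam_of_mem (s.isBounded_cube k x) hy
      (s.pt_mem_cube k hx)).trans_lt hlt'⟩
  have h1 := (s.le_measure_cube hE k hx).trans ((measure_mono hsub).trans
    (hE.2.2 _ (s.pt_mem k x hx) _ (by positivity)).2)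
  rw [ENNReal.ofReal_le_ofReal_iff (by positivity), mul_pow] at h1
  have hp : (0 : ℝ) < (256 ^ k / 8) ^ d := by positivity
  have h2 : a⁻¹ ≤ a * t ^ d := by
    refine le_of_mul_le_mul_right ?_ hp
    linarith
  have h3 : t ^ d ≤ t := pow_le_of_le_one ht0.le ht1 hd.ne'
  have h4 : a * t = a⁻¹ / 2 := by
    rw [ht]
    field_simp
  have h5 : 0 < a⁻¹ := by positivity
  nlinarith

/-- The points of the cube of `x₀` which, in the first `m` generations of subcubes, avoid the
subcube containing the centre. -/
def layer (k : ℤ) (x₀ : EuclideanSpace ℝ (Fin n)) (m : ℕ) : Set (EuclideanSpace ℝ (Fin n)) :=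
  {x ∈ s.cube k x₀ | ∀ i : ℕ, i < m →
    256 ^ (k - i) / 32 ≤ dist (s.pt (k - i - 1) x) (s.pt (k - i) x)}

lemma inter_ball_subset_layer (k : ℤ) {x₀ x : EuclideanSpace ℝ (Fin n)} (m : ℕ)
    (hx : x ∈ s.layer k x₀ m) :
    E ∩ Metric.ball (s.pt (k - m) x) (256 ^ (k - m) / 64) ⊆ s.layer k x₀ m := by
  rintro y ⟨hy, hyx⟩
  have hxE : x ∈ E := hx.1.1
  have h1 : s.pt (k - m) y = s.pt (k - m) x := by
    refine s.pt_eq _ x hxE y hy ?_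
    rw [Metric.mem_ball] at hyx
    have : (0 : ℝ) < 256 ^ (k - m) := by positivity
    linarith
  have h2 : ∀ j, k - m ≤ j → s.pt j y = s.pt j x := fun j hj => s.pt_mono hj hy hxE h1
  refine ⟨⟨hy, (h2 k (by omega)).trans hx.1.2⟩, fun i hi => ?_⟩
  rw [h2 _ (by omega), h2 _ (by omega)]
  exact hx.2 i hi

lemma layer_succ_subset (k : ℤ) (x₀ : EuclideanSpace ℝ (Fin n)) (m : ℕ) :
    s.layer k x₀ (m + 1) ⊆ s.layer k x₀ m \
      ⋃ w ∈ s.pt (k - m) '' s.layer k x₀ m, E ∩ Metric.ball w (256 ^ (k - m) / 64) := by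
  intro x hx
  refine ⟨⟨hx.1, fun i hi => hx.2 i (by omega)⟩, fun hmem => ?_⟩
  obtain ⟨_, ⟨x', hx', rfl⟩, -, hball⟩ := Set.mem_iUnion₂.1 hmem
  have hl : (256 : ℝ) ^ (k - m) = 256 * 256 ^ (k - m - 1) := by
    rw [← zpow_one_add₀ (by norm_num)]
    congr 1
    ring
  have hl0 : (0 : ℝ) < 256 ^ (k - m - 1) := by positivity
  rw [Metric.mem_ball] at hball
  have h1 : s.pt (k - m) x = s.pt (k - m) x' :=
    s.pt_eq _ x' hx'.1.1 x hx.1.1 (by linarith)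
  have h2 := hx.2 m (Nat.lt_succ_self m)
  rw [h1] at h2
  have h3 := s.dist_le (k - m - 1) x hx.1.1
  have h4 := dist_triangle_left (s.pt (k - m - 1) x) (s.pt (k - m) x') x
  linarith

/-- In each cube, the subcube around the centre carries a fixed proportion of the measure. The
cubes need not be measurable, so it is the measurable balls inside them that are split off. -/
lemma measure_layer_succ_le (ha : 1 ≤ a) (hE : IsAhlforsRegular d a E) (k : ℤ)
    {x₀ : EuclideanSpace ℝ (Fin n)} (hx₀ : x₀ ∈ E) (m : ℕ) :
    normHausdorff n d (s.layer k x₀ (m + 1)) ≤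
      ENNReal.ofReal (1 - (a ^ 2 * 192 ^ d)⁻¹) * normHausdorff n d (s.layer k x₀ m) := by
  set U := s.layer k x₀ m with hU
  set c : ℝ := (a ^ 2 * 192 ^ d)⁻¹ with hc
  set B := ⋃ w ∈ s.pt (k - m) '' U, E ∩ Metric.ball w (256 ^ (k - m) / 64) with hB
  have hl0 : (0 : ℝ) < 256 ^ (k - m) := by positivity
  have hUE : U ⊆ E := fun x hx => hx.1.1
  have hfin : (s.pt (k - m) '' U).Finite :=
    s.finite_image_pt _ hUE ((s.isBounded_cube k x₀).subset fun x hx => hx.1)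
  have hBmeas : MeasurableSet B := hfin.measurableSet_biUnion fun w _ =>
    hE.1.measurableSet.inter Metric.isOpen_ball.measurableSet
  have hBU : B ⊆ U := by
    refine Set.iUnion₂_subset ?_
    rintro _ ⟨x, hx, rfl⟩
    exact s.inter_ball_subset_layer k m hx
  have hUfin : normHausdorff n d U ≠ ∞ :=
    ((measure_mono fun x hx => hx.1).trans (s.measure_cube_le hE k hx₀)).trans_lt
      ENNReal.ofReal_lt_top |>.ne
  have hUle : normHausdorff n d U ≤
      ∑ w ∈ hfin.toFinset, ENNReal.ofReal (a * (3 * 256 ^ (k - m)) ^ d) := by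
    have hcov : U ⊆ ⋃ w ∈ hfin.toFinset, {y ∈ E | s.pt (k - m) y = w} := fun x hx =>
      Set.mem_biUnion (x := s.pt (k - m) x) (by simpa using ⟨x, hx, rfl⟩) ⟨hUE hx, rfl⟩
    refine (measure_mono hcov).trans ((measure_biUnion_finset_le _ _).trans ?_)
    refine Finset.sum_le_sum fun w hw => ?_
    obtain ⟨x, hx, rfl⟩ := hfin.mem_toFinset.1 hw
    exact s.measure_cube_le hE _ (hUE hx)
  have hBge : ∑ w ∈ hfin.toFinset, ENNReal.ofReal (a⁻¹ * (256 ^ (k - m) / 64) ^ d) ≤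
      normHausdorff n d B := by
    have hB' : B = ⋃ w ∈ hfin.toFinset, E ∩ Metric.ball w (256 ^ (k - m) / 64) := by
      rw [hB]
      ext y
      simp
    rw [hB', measure_biUnion_finset]
    · refine Finset.sum_le_sum fun w hw => ?_
      obtain ⟨x, hx, rfl⟩ := hfin.mem_toFinset.1 hw
      exact (hE.2.2 _ (s.pt_mem _ x (hUE hx)) _ (by positivity)).1
    · intro w hw w' hw' hne
      obtain ⟨x, hx, rfl⟩ := hfin.mem_toFinset.1 hw
      obtain ⟨x', hx', rfl⟩ := hfin.mem_toFinset.1 hw'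
      refine Set.disjoint_left.2 fun y hy hy' => hne ?_
      have hb := hy.2
      have hb' := hy'.2
      rw [Metric.mem_ball] at hb hb'
      rw [← s.pt_eq _ x (hUE hx) y hy.1 (by linarith),
        ← s.pt_eq _ x' (hUE hx') y hy.1 (by linarith)]
    · exact fun w _ => hE.1.measurableSet.inter Metric.isOpen_ball.measurableSet
  have hcle : ENNReal.ofReal c * normHausdorff n d U ≤ normHausdorff n d B := by
    refine le_trans ?_ hBge
    refine (mul_le_mul_right hUle _).trans (le_of_eq ?_)
    rw [Finset.mul_sum]
    refine Finset.sum_congr rfl fun w _ => ?_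
    rw [← ENNReal.ofReal_mul (by positivity)]
    congr 1
    have h192 : (192 : ℝ) ^ d = 3 ^ d * 64 ^ d := by rw [← mul_pow]; norm_num
    rw [hc, mul_pow, div_pow, h192]
    field_simp
  have hsplit := measure_inter_add_sdiff (μ := normHausdorff n d) U hBmeas
  rw [Set.inter_eq_self_of_subset_right hBU] at hsplit
  have hadd : normHausdorff n d (U \ B) + ENNReal.ofReal c * normHausdorff n d U ≤
      normHausdorff n d U := by
    calc _ ≤ normHausdorff n d (U \ B) + normHausdorff n d B := by gcongr
      _ = normHausdorff n d U := by rw [add_comm, hsplit]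
  refine (measure_mono (s.layer_succ_subset k x₀ m)).trans ?_
  rw [ENNReal.ofReal_sub _ (by positivity), ENNReal.sub_mul fun _ _ => hUfin, ENNReal.ofReal_one,
    one_mul]
  exact ENNReal.le_sub_of_add_le_right
    (ENNReal.mul_ne_top ENNReal.ofReal_ne_top hUfin) hadd

lemma measure_layer_le (ha : 1 ≤ a) (hE : IsAhlforsRegular d a E) (k : ℤ)
    {x₀ : EuclideanSpace ℝ (Fin n)} (hx₀ : x₀ ∈ E) (m : ℕ) :
    normHausdorff n d (s.layer k x₀ m) ≤
      ENNReal.ofReal ((1 - (a ^ 2 * 192 ^ d)⁻¹) ^ m * (a * (3 * 256 ^ k) ^ d)) := by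
  have hc : 0 ≤ 1 - (a ^ 2 * 192 ^ d)⁻¹ := by
    have : (1 : ℝ) ≤ a ^ 2 * 192 ^ d :=
      one_le_mul_of_one_le_of_one_le (one_le_pow₀ ha) (one_le_pow₀ (by norm_num))
    linarith [inv_le_one_of_one_le₀ this]
  induction m with
  | zero =>
    rw [pow_zero, one_mul]
    exact (measure_mono fun x hx => hx.1).trans (s.measure_cube_le hE k hx₀)
  | succ m ih =>
    refine (s.measure_layer_succ_le ha hE k hx₀ m).trans ?_
    rw [pow_succ' _ m, mul_assoc, ENNReal.ofReal_mul hc]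
    gcongr

/-- A point of a cube close to its complement avoids the subcubes around the centre in all the
generations coarser than its distance to the complement. -/
lemma boundary_subset_layer (k : ℤ) (x₀ : EuclideanSpace ℝ (Fin n)) (m : ℕ) {τ : ℝ}
    (hτ : τ ≤ (256 ^ m)⁻¹) :
    {x ∈ s.cube k x₀ | Metric.infEDist x (E \ s.cube k x₀) ≤ ENNReal.ofReal (τ * 256 ^ k)} ⊆
      s.layer k x₀ m := by
  rintro x ⟨hx, hdist⟩
  refine ⟨hx, fun i hi => ?_⟩
  by_contra! hlt
  have hl : (256 : ℝ) ^ (k - i) = 256 * 256 ^ (k - i - 1) := by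
    rw [← zpow_one_add₀ (by norm_num)]
    congr 1
    ring
  have hl0 : (0 : ℝ) < 256 ^ (k - i - 1) := by positivity
  have hτi : τ * 256 ^ k ≤ 256 ^ (k - i - 1) := by
    calc τ * 256 ^ k ≤ (256 ^ m)⁻¹ * 256 ^ k := by gcongr
      _ = 256 ^ (k - m) := by
        rw [zpow_sub₀ (by norm_num), zpow_natCast, div_eq_mul_inv, mul_comm]
      _ ≤ 256 ^ (k - i - 1) := zpow_le_zpow_right₀ (by norm_num) (by omega)
  have hnear : Metric.infEDist x (E \ s.cube k x₀) < ENNReal.ofReal (2 * 256 ^ (k - i - 1)) := by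
    refine hdist.trans_lt ?_
    rw [ENNReal.ofReal_lt_ofReal_iff (by positivity)]
    linarith
  obtain ⟨y, ⟨hy, hyQ⟩, hxy⟩ := Metric.infEDist_lt_iff.1 hnear
  rw [edist_lt_ofReal] at hxy
  have h1 := s.dist_le (k - i - 1) x hx.1
  have h2 := dist_triangle_left y (s.pt (k - i) x) x
  have h3 := dist_triangle x (s.pt (k - i - 1) x) (s.pt (k - i) x)
  have h4 : s.pt (k - i) y = s.pt (k - i) x :=
    s.pt_eq _ x hx.1 y hy (by linarith)
  exact hyQ ⟨hy, (s.pt_mono (by omega) hy hx.1 h4).trans hx.2⟩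

/-- The boundary layers of the cubes decay like a power of their relative width. The exponent `η` is
such that `256 ^ (-η)` bounds the proportion of measure that survives one generation; smaller
exponents are allowed as well. -/
lemma exists_boundary_exponent (hd : d ≠ 0) (ha : 1 ≤ a) :
    ∃ η : ℝ, 0 < η ∧ ∀ θ : ℝ, 0 < θ → θ ≤ η → ∀ (n : ℕ) (E : Set (EuclideanSpace ℝ (Fin n)))
      (s : DyadicChains E), IsAhlforsRegular d a E → ∀ (k : ℤ), ∀ x₀ ∈ E, ∀ τ : ℝ, 0 < τ →
      normHausdorff n d
        {x ∈ s.cube k x₀ | Metric.infEDist x (E \ s.cube k x₀) ≤ ENNReal.ofReal (τ * 256 ^ k)} ≤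
      ENNReal.ofReal (2 * a * 3 ^ d * τ ^ θ * (256 ^ k) ^ d) := by
  set c : ℝ := (a ^ 2 * 192 ^ d)⁻¹ with hc
  have h192 : (192 : ℝ) ≤ 192 ^ d := le_self_pow₀ (by norm_num) hd
  have hc2 : c ≤ 1 / 2 := by
    rw [hc]
    refine inv_le_of_inv_le₀ (by norm_num) ?_
    nlinarith [one_le_pow₀ (n := 2) ha]
  have hc0 : 0 < c := by positivity
  set η : ℝ := -Real.logb 256 (1 - c) with hη
  have hη0 : 0 < η := by
    have := Real.logb_neg (b := 256) (by norm_num) (x := 1 - c) (by linarith) (by linarith)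
    linarith
  have hpow : (256 : ℝ) ^ (-η) = 1 - c := by
    rw [hη, neg_neg, Real.rpow_logb (by norm_num) (by norm_num) (by linarith)]
  refine ⟨η, hη0, fun θ hθ hθη n E s hE k x₀ hx₀ τ hτ => ?_⟩
  have ha0 : 0 < a := by linarith
  rcases le_or_gt 1 τ with h1 | h1
  · refine (measure_mono fun x hx => hx.1).trans ((s.measure_cube_le hE k hx₀).trans ?_)
    refine ENNReal.ofReal_le_ofReal ?_
    have h2 : 1 ≤ τ ^ θ := Real.one_le_rpow h1 hθ.le
    rw [mul_pow]
    calc a * (3 ^ d * (256 ^ k) ^ d) = 1 * a * 3 ^ d * 1 * (256 ^ k) ^ d := by ring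
      _ ≤ 2 * a * 3 ^ d * τ ^ θ * (256 ^ k) ^ d := by gcongr; norm_num
  · obtain ⟨m, hm1, hm2⟩ := exists_nat_pow_near_of_lt_one hτ h1.le
      (y := (1 / 256 : ℝ)) (by norm_num) (by norm_num)
    refine (measure_mono (s.boundary_subset_layer k x₀ m (τ := τ) ?_)).trans
      ((s.measure_layer_le ha hE k hx₀ m).trans (ENNReal.ofReal_le_ofReal ?_))
    · rw [← inv_pow, inv_eq_one_div]
      exact hm2
    · have h3 : (1 - c) ^ (m + 1) ≤ τ ^ θ := by
        calc (1 - c) ^ (m + 1) = (((1 / 256 : ℝ)) ^ (m + 1)) ^ η := by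
              rw [← hpow, ← Real.rpow_natCast, ← Real.rpow_natCast, ← Real.rpow_mul (by norm_num),
                ← Real.rpow_mul (by norm_num), one_div, Real.inv_rpow (by norm_num),
                ← Real.rpow_neg (by norm_num)]
              congr 1
              ring
          _ ≤ τ ^ η := by gcongr
          _ ≤ τ ^ θ := Real.rpow_le_rpow_of_exponent_ge hτ h1.le hθη
      have h4 : (1 - c) ^ m ≤ 2 * τ ^ θ := by
        have h5 : 0 ≤ (1 - c) ^ m := pow_nonneg (by linarith) m
        rw [pow_succ] at h3
        nlinarith
      rw [mul_pow]
      calc (1 - c) ^ m * (a * (3 ^ d * (256 ^ k) ^ d))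
          ≤ (2 * τ ^ θ) * (a * (3 ^ d * (256 ^ k) ^ d)) := by gcongr
        _ = _ := by ring

end DyadicChains

lemma two_zpow_bounds (j : ℤ) :
    (256 : ℝ) ^ (j / 8) ≤ 2 ^ j ∧ (2 : ℝ) ^ j ≤ 256 * 256 ^ (j / 8) := by
  have h : ∀ i : ℤ, (256 : ℝ) ^ i = 2 ^ (8 * i) := fun i => by
    rw [zpow_mul]
    norm_num
  have h8 : (256 : ℝ) * 2 ^ (8 * (j / 8)) = 2 ^ (8 * (j / 8) + 8) := by
    rw [zpow_add₀ (by norm_num)]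
    norm_num [mul_comm]
  rw [h, h8]
  exact ⟨zpow_le_zpow_right₀ (by norm_num) (by omega),
    zpow_le_zpow_right₀ (by norm_num) (by omega)⟩

/-- The cubes of side `256 ^ k` serve as dyadic cubes for the eight generations
`8 * k, …, 8 * k + 7`. -/
theorem exists_dyadicSystem {d : ℕ} (hd : 0 < d) {a : ℝ} (ha : 1 ≤ a) :
    ∃ C : ℝ, 1 < C ∧ ∀ (n : ℕ) (E : Set (EuclideanSpace ℝ (Fin n))), IsAhlforsRegular d a E →
      Nonempty (DyadicSystem d E C) := by
  obtain ⟨η, hη, hbd⟩ := DyadicChains.exists_boundary_exponent hd.ne' ha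
  set C : ℝ := 4096 * a ^ 2 + a * 2048 ^ d + 512 * a * 3 ^ d + 1 / η with hC
  have ha0 : 0 < a := by linarith
  have ht1 : 4096 ≤ 4096 * a ^ 2 := by nlinarith
  have ht2 : 0 < a * 2048 ^ d := by positivity
  have ht3 : 0 < 512 * a * 3 ^ d := by positivity
  have ht4 : 0 < 1 / η := by positivity
  have hC0 : 0 < C := by linarith
  have hCη : 1 / C ≤ η := (one_div_le hC0 hη).2 (by linarith)
  refine ⟨C, by linarith, fun n E hE => ?_⟩
  obtain ⟨s⟩ := nonempty_dyadicChains E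
  classical
  -- One set can be a cube at several scales; its centre refers to a choice of one of them. Both the
  -- diameter of the set and the depth of the centre are comparable to the chosen scale.
  let cen : Set (EuclideanSpace ℝ (Fin n)) → EuclideanSpace ℝ (Fin n) := fun Q =>
    if h : ∃ p : ℤ × EuclideanSpace ℝ (Fin n), p.2 ∈ E ∧ Q = s.cube p.1 p.2 then
      s.pt h.choose.1 h.choose.2 else 0
  have hcen : ∀ (k : ℤ), ∀ x ∈ E, ∃ (k' : ℤ), ∃ x' ∈ E, s.cube k x = s.cube k' x' ∧
      cen (s.cube k x) = s.pt k' x' := by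
    intro k x hx
    have h : ∃ p : ℤ × EuclideanSpace ℝ (Fin n), p.2 ∈ E ∧ s.cube k x = s.cube p.1 p.2 :=
      ⟨(k, x), hx, rfl⟩
    refine ⟨h.choose.1, h.choose.2, h.choose_spec.1, h.choose_spec.2, ?_⟩
    simp only [cen]
    rw [dif_pos h]
  refine ⟨{
    cubes := fun j => s.cube (j / 8) '' E
    center := cen
    one_le := by linarith
    sUnion_eq := fun j => ?_
    pairwiseDisjoint := fun j => ?_
    nested := ?_
    diam_bounds := ?_
    measure_bounds := ?_
    small_boundary := ?_
    center_mem := ?_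
    center_dist := ?_ }⟩
  · ext x
    simp only [Set.sUnion_image, Set.mem_iUnion, exists_prop]
    constructor
    · rintro ⟨y, -, hxy⟩
      exact hxy.1
    · exact fun hx => ⟨x, hx, hx, rfl⟩
  · rintro _ ⟨x, hx, rfl⟩ _ ⟨y, hy, rfl⟩ hne
    refine Set.disjoint_left.2 fun z hz hz' => hne ?_
    have : s.pt (j / 8) x = s.pt (j / 8) y := hz.2.symm.trans hz'.2
    simp only [DyadicChains.cube, this]
  · rintro j k hjk _ ⟨x, hx, rfl⟩ _ ⟨y, hy, rfl⟩
    have hjk' : j / 8 ≤ k / 8 := by omega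
    rw [or_iff_not_imp_left, Set.not_disjoint_iff]
    rintro ⟨z, hz, hz'⟩ w hw
    exact ⟨hw.1, (s.pt_mono hjk' hw.1 hz.1 (hw.2.trans hz.2.symm)).trans hz'.2⟩
  · rintro j _ ⟨x, hx, rfl⟩
    obtain ⟨h1, h2⟩ := two_zpow_bounds j
    have hl : (0 : ℝ) < 256 ^ (j / 8) := by positivity
    constructor
    · refine le_trans ?_ (s.le_diam_cube hd ha hE (j / 8) hx)
      rw [inv_mul_le_iff₀ hC0]
      refine h2.trans ?_
      rw [← mul_assoc]
      gcongr
      rw [le_mul_inv_iff₀ (by positivity)]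
      linarith
    · refine (s.diam_cube_le (j / 8) x).trans ?_
      gcongr
      linarith
  · rintro j _ ⟨x, hx, rfl⟩
    obtain ⟨h1, h2⟩ := two_zpow_bounds j
    have hl : (0 : ℝ) < 256 ^ (j / 8) := by positivity
    constructor
    · refine le_trans (ENNReal.ofReal_le_ofReal ?_) (s.le_measure_cube hE (j / 8) hx)
      rw [inv_mul_le_iff₀ hC0]
      calc ((2 : ℝ) ^ j) ^ d ≤ (256 * 256 ^ (j / 8)) ^ d := by gcongr
        _ = (a * 2048 ^ d) * (a⁻¹ * (256 ^ (j / 8) / 8) ^ d) := by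
          rw [show (2048 : ℝ) = 256 * 8 by norm_num, mul_pow, mul_pow, div_pow]
          field_simp
        _ ≤ C * (a⁻¹ * (256 ^ (j / 8) / 8) ^ d) := by
          gcongr
          linarith
    · refine (s.measure_cube_le hE (j / 8) hx).trans (ENNReal.ofReal_le_ofReal ?_)
      calc a * (3 * 256 ^ (j / 8)) ^ d = (a * 3 ^ d) * (256 ^ (j / 8)) ^ d := by
            rw [mul_pow]; ring
        _ ≤ C * ((2 : ℝ) ^ j) ^ d := by
          gcongr
          linarith
  · rintro j _ ⟨x, hx, rfl⟩ τ hτ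
    obtain ⟨h1, h2⟩ := two_zpow_bounds j
    have hl : (0 : ℝ) < 256 ^ (j / 8) := by positivity
    have hsub : {y ∈ s.cube (j / 8) x | Metric.infEDist y (E \ s.cube (j / 8) x) ≤
          ENNReal.ofReal (τ * 2 ^ j)} ⊆
        {y ∈ s.cube (j / 8) x | Metric.infEDist y (E \ s.cube (j / 8) x) ≤
          ENNReal.ofReal (256 * τ * 256 ^ (j / 8))} := by
      refine fun y hy => ⟨hy.1, hy.2.trans (ENNReal.ofReal_le_ofReal ?_)⟩
      nlinarith
    refine (measure_mono hsub).trans ((hbd (1 / C) (by positivity) hCη n E s hE (j / 8) x hx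
      (256 * τ) (by positivity)).trans (ENNReal.ofReal_le_ofReal ?_))
    have h256 : (256 : ℝ) ^ (1 / C) ≤ 256 := by
      have : 1 / C ≤ 1 := (div_le_one hC0).2 (by linarith)
      calc (256 : ℝ) ^ (1 / C) ≤ 256 ^ (1 : ℝ) :=
            Real.rpow_le_rpow_of_exponent_le (by norm_num) this
        _ = 256 := Real.rpow_one _
    rw [Real.mul_rpow (by norm_num) hτ.le]
    have hτ' : 0 < τ ^ (1 / C) := Real.rpow_pos_of_pos hτ _
    calc 2 * a * 3 ^ d * (256 ^ (1 / C) * τ ^ (1 / C)) * (256 ^ (j / 8)) ^ d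
        ≤ 2 * a * 3 ^ d * (256 * τ ^ (1 / C)) * (2 ^ j) ^ d := by gcongr
      _ = (512 * a * 3 ^ d) * τ ^ (1 / C) * (2 ^ j) ^ d := by ring
      _ ≤ C * τ ^ (1 / C) * (2 ^ j) ^ d := by
        gcongr
        linarith
  · rintro j _ ⟨x, hx, rfl⟩
    obtain ⟨k', x', hx', hQ, hc⟩ := hcen (j / 8) x hx
    rw [hc, hQ]
    exact s.pt_mem_cube k' hx'
  · rintro j _ ⟨x, hx, rfl⟩
    obtain ⟨k', x', hx', hQ, hc⟩ := hcen (j / 8) x hx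
    rw [hc, hQ]
    have hl : (0 : ℝ) < 256 ^ k' := by positivity
    refine Metric.le_infEDist.2 fun y hy => ?_
    rw [edist_dist]
    refine ENNReal.ofReal_le_ofReal ?_
    have hfar : 256 ^ k' / 8 ≤ dist (s.pt k' x') y := by
      by_contra! hlt
      refine hy.2 (s.inter_ball_subset_cube k' hx' ⟨hy.1, ?_⟩)
      rwa [Metric.mem_ball, dist_comm]
    refine le_trans ?_ hfar
    rw [inv_mul_le_iff₀ hC0]
    have := s.diam_cube_le k' x'
    nlinarith

/-! ### Elementary properties of dyadic cubes -/

namespace DyadicSystem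

variable {n d : ℕ} {E : Set (EuclideanSpace ℝ (Fin n))} {C : ℝ} {Δ : DyadicSystem d E C}

namespace Cube

lemma le_refl (Q : Δ.Cube) : Q ≤ Q := ⟨_root_.le_refl _, subset_rfl⟩

lemma le_trans {Q Q' Q'' : Δ.Cube} (h : Q ≤ Q') (h' : Q' ≤ Q'') : Q ≤ Q'' :=
  ⟨h.1.trans h'.1, h.2.trans h'.2⟩

lemma eq_of_gen_eq {Q Q' : Δ.Cube} (h : Q.gen = Q'.gen) (h' : Q.carrier = Q'.carrier) :
    Q = Q' := by
  cases Q
  cases Q'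
  cases h
  cases h'
  rfl

lemma center_mem (Q : Δ.Cube) : Δ.center Q.carrier ∈ Q.carrier := Δ.center_mem _ _ Q.mem

lemma carrier_subset (Q : Δ.Cube) : Q.carrier ⊆ E :=
  (Set.subset_sUnion_of_mem Q.mem).trans_eq (Δ.sUnion_eq Q.gen)

lemma le_of_mem {Q Q' : Δ.Cube} (h : Q.gen ≤ Q'.gen) {x : EuclideanSpace ℝ (Fin n)}
    (hx : x ∈ Q.carrier) (hx' : x ∈ Q'.carrier) : Q ≤ Q' :=
  ⟨h, (Δ.nested _ _ h _ Q.mem _ Q'.mem).resolve_left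
    fun hd => Set.disjoint_left.1 hd hx hx'⟩

lemma eq_of_mem {Q Q' : Δ.Cube} (h : Q.gen = Q'.gen) {x : EuclideanSpace ℝ (Fin n)}
    (hx : x ∈ Q.carrier) (hx' : x ∈ Q'.carrier) : Q = Q' :=
  eq_of_gen_eq h ((le_of_mem h.le hx hx').2.antisymm (le_of_mem h.ge hx' hx).2)

lemma eq_of_le {Q Q' : Δ.Cube} (h : Q ≤ Q') (h' : Q'.gen ≤ Q.gen) : Q = Q' :=
  eq_of_mem (h.1.antisymm h') Q.center_mem (h.2 Q.center_mem)

/-- Of two cubes that contain a common cube, the one of smaller generation is contained in the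
other. -/
lemma le_of_le_of_le {Q Q₁ Q₂ : Δ.Cube} (h₁ : Q ≤ Q₁) (h₂ : Q ≤ Q₂) (h : Q₁.gen ≤ Q₂.gen) :
    Q₁ ≤ Q₂ :=
  le_of_mem h (h₁.2 Q.center_mem) (h₂.2 Q.center_mem)

lemma exists_parent (Q : Δ.Cube) : ∃ P : Δ.Cube, IsChild Q P := by
  have hc : Δ.center Q.carrier ∈ ⋃₀ Δ.cubes (Q.gen + 1) := by
    rw [Δ.sUnion_eq]
    exact Q.carrier_subset Q.center_mem
  obtain ⟨P, hP, hcP⟩ := hc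
  exact ⟨⟨Q.gen + 1, P, hP⟩, rfl,
    (le_of_mem (Q' := ⟨Q.gen + 1, P, hP⟩) (by simp) Q.center_mem hcP).2⟩

/-- The cube of the next coarser generation that contains `Q`. -/
noncomputable def parent (Q : Δ.Cube) : Δ.Cube := Q.exists_parent.choose

lemma isChild_parent (Q : Δ.Cube) : IsChild Q Q.parent := Q.exists_parent.choose_spec

lemma gen_parent (Q : Δ.Cube) : Q.parent.gen = Q.gen + 1 := Q.isChild_parent.1.symm

lemma le_parent (Q : Δ.Cube) : Q ≤ Q.parent :=
  ⟨by rw [gen_parent]; omega, Q.isChild_parent.2⟩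

lemma parent_le {Q Q' : Δ.Cube} (h : Q ≤ Q') (hlt : Q.gen < Q'.gen) : Q.parent ≤ Q' :=
  le_of_le_of_le Q.le_parent h (by rw [gen_parent]; omega)

lemma parent_eq_of_isChild {Q P : Δ.Cube} (h : IsChild Q P) : Q.parent = P :=
  eq_of_mem (by rw [gen_parent, h.1]) (Q.le_parent.2 Q.center_mem) (h.2 Q.center_mem)

lemma diam_pos (Q : Δ.Cube) : 0 < Metric.diam Q.carrier := by
  have hC : 0 < C := zero_lt_one.trans_le Δ.one_le
  have : 0 < C⁻¹ * (2 : ℝ) ^ Q.gen := by positivity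
  exact this.trans_le (Δ.diam_bounds _ _ Q.mem).1

lemma isBounded (Q : Δ.Cube) : Bornology.IsBounded Q.carrier := by
  by_contra h
  exact Q.diam_pos.ne' (Metric.diam_eq_zero_of_unbounded h)

lemma diam_le {K : ℝ} (hK : C ≤ K) (Q : Δ.Cube) :
    Metric.diam Q.carrier ≤ K * (2 : ℝ) ^ Q.gen :=
  (Δ.diam_bounds _ _ Q.mem).2.trans (by gcongr)

lemma le_diam {K : ℝ} (hK : C ≤ K) (Q : Δ.Cube) :
    K⁻¹ * (2 : ℝ) ^ Q.gen ≤ Metric.diam Q.carrier := by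
  have hC : 0 < C := zero_lt_one.trans_le Δ.one_le
  exact _root_.le_trans (by gcongr) (Δ.diam_bounds _ _ Q.mem).1

lemma le_measure {K : ℝ} (hK : C ≤ K) (Q : Δ.Cube) :
    ENNReal.ofReal (K⁻¹ * ((2 : ℝ) ^ Q.gen) ^ d) ≤ normHausdorff n d Q.carrier := by
  have hC : 0 < C := zero_lt_one.trans_le Δ.one_le
  exact _root_.le_trans (ENNReal.ofReal_le_ofReal (by gcongr)) (Δ.measure_bounds _ _ Q.mem).1

lemma dist_le {K : ℝ} (hK : C ≤ K) (Q : Δ.Cube) {x y : EuclideanSpace ℝ (Fin n)}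
    (hx : x ∈ Q.carrier) (hy : y ∈ Q.carrier) : dist x y ≤ K * (2 : ℝ) ^ Q.gen :=
  (Metric.dist_le_diam_of_mem Q.isBounded hx hy).trans (Q.diam_le hK)

/-- By the small boundary condition, a cube is relatively open in `E` up to a null set. -/
lemma nullMeasurableSet (hE : IsClosed E) (Q : Δ.Cube) :
    NullMeasurableSet Q.carrier (normHausdorff n d) := by
  set Z := {x ∈ Q.carrier | Metric.infEDist x (E \ Q.carrier) ≤ 0} with hZ
  have hC : 0 < C := zero_lt_one.trans_le Δ.one_le
  have hZ0 : normHausdorff n d Z = 0 := by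
    have hlim : Filter.Tendsto
        (fun τ : ℝ => ENNReal.ofReal (C * τ ^ (1 / C) * ((2 : ℝ) ^ Q.gen) ^ d))
        (nhdsWithin 0 (Set.Ioi 0)) (nhds 0) := by
      have hcont : Continuous fun τ : ℝ =>
          ENNReal.ofReal (C * τ ^ (1 / C) * ((2 : ℝ) ^ Q.gen) ^ d) := by
        refine ENNReal.continuous_ofReal.comp ?_
        exact (continuous_const.mul (Real.continuous_rpow_const (by positivity))).mul
          continuous_const
      have h0 := hcont.tendsto 0
      rw [Real.zero_rpow (by positivity), mul_zero, zero_mul, ENNReal.ofReal_zero] at h0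
      exact h0.mono_left nhdsWithin_le_nhds
    refine le_antisymm (ge_of_tendsto hlim ?_) zero_le
    filter_upwards [self_mem_nhdsWithin] with τ hτ
    have hsub : Z ⊆ {x ∈ Q.carrier | Metric.infEDist x (E \ Q.carrier) ≤
        ENNReal.ofReal (τ * (2 : ℝ) ^ Q.gen)} := fun x hx => ⟨hx.1, hx.2.trans zero_le⟩
    exact (measure_mono hsub).trans (Δ.small_boundary _ _ Q.mem τ hτ)
  have hQ : Q.carrier = (E ∩ {x | 0 < Metric.infEDist x (E \ Q.carrier)}) ∪ Z := by
    ext x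
    constructor
    · intro hx
      rcases eq_or_ne (Metric.infEDist x (E \ Q.carrier)) 0 with h | h
      · exact Or.inr ⟨hx, h.le⟩
      · exact Or.inl ⟨Q.carrier_subset hx, pos_iff_ne_zero.2 h⟩
    · rintro (⟨hxE, hx⟩ | hx)
      · by_contra hxQ
        exact hx.ne' (Metric.infEDist_zero_of_mem (s := E \ Q.carrier) ⟨hxE, hxQ⟩)
      · exact hx.1
  rw [hQ]
  refine NullMeasurableSet.union ?_ (NullMeasurableSet.of_null hZ0)
  exact (hE.measurableSet.inter
    (isOpen_Ioi.preimage Metric.continuous_infEDist).measurableSet).nullMeasurableSet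

/-- The measures of pairwise disjoint cubes contained in a set add up to at most its measure. -/
lemma tsum_measure_le (hE : IsClosed E) {𝒬 : Set Δ.Cube}
    (hdisj : 𝒬.PairwiseDisjoint carrier) {A : Set (EuclideanSpace ℝ (Fin n))}
    (hA : ∀ Q ∈ 𝒬, Q.carrier ⊆ A) :
    ∑' Q : 𝒬, normHausdorff n d Q.1.carrier ≤ normHausdorff n d A := by
  refine (tsum_meas_le_meas_iUnion_of_disjoint₀ (normHausdorff n d)
    (As := fun Q : 𝒬 => Q.1.carrier) (fun Q => Q.1.nullMeasurableSet hE) ?_).trans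
    (measure_mono (Set.iUnion_subset fun Q => hA Q.1 Q.2))
  intro Q Q' hne
  exact (hdisj Q.2 Q'.2 fun h => hne (Subtype.ext h)).aedisjoint

end Cube

/-! ### Stopping-time families of cubes -/

section StoppingTime

open Classical in
/-- The recursion behind `stoppingTop`, `k` generations below the initial one. -/
noncomputable def stoppingTopAux (good : Δ.Cube → Δ.Cube → Prop) : ℕ → Δ.Cube → Δ.Cube
  | 0, Q => Q
  | k + 1, Q =>
    if ∀ Q' : Δ.Cube, IsChild Q' Q.parent → good (stoppingTopAux good k Q.parent) Q' then
      stoppingTopAux good k Q.parent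
    else Q

/-- The maximal cube of the stopping-time family of `Q`. The cubes of generation `j₀` start a
family; a cube stays in the family, with maximal cube `T`, of its parent when it and all its
siblings `Q'` satisfy `good T Q'`, and starts a new family otherwise. -/
noncomputable def stoppingTop (good : Δ.Cube → Δ.Cube → Prop) (j₀ : ℤ) (Q : Δ.Cube) : Δ.Cube :=
  stoppingTopAux good (j₀ - Q.gen).toNat Q

variable (good : Δ.Cube → Δ.Cube → Prop) (j₀ : ℤ)

lemma stoppingTop_of_le {Q : Δ.Cube} (h : j₀ ≤ Q.gen) : stoppingTop good j₀ Q = Q := by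
  have h0 : (j₀ - Q.gen).toNat = 0 := by omega
  rw [stoppingTop, h0]
  rfl

open Classical in
lemma stoppingTop_of_lt {Q : Δ.Cube} (h : Q.gen < j₀) : stoppingTop good j₀ Q =
    if ∀ Q' : Δ.Cube, IsChild Q' Q.parent → good (stoppingTop good j₀ Q.parent) Q' then
      stoppingTop good j₀ Q.parent
    else Q := by
  have h0 : (j₀ - Q.gen).toNat = (j₀ - Q.parent.gen).toNat + 1 := by
    rw [Cube.gen_parent]
    omega
  rw [stoppingTop, h0]
  rfl

lemma stoppingTop_eq_or (Q : Δ.Cube) : stoppingTop good j₀ Q = Q ∨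
    Q.gen < j₀ ∧ stoppingTop good j₀ Q = stoppingTop good j₀ Q.parent ∧
      ∀ Q' : Δ.Cube, IsChild Q' Q.parent → good (stoppingTop good j₀ Q.parent) Q' := by
  rcases le_or_gt j₀ Q.gen with h | h
  · exact Or.inl (stoppingTop_of_le good j₀ h)
  · rw [stoppingTop_of_lt good j₀ h]
    split_ifs with hg
    · exact Or.inr ⟨h, rfl, hg⟩
    · exact Or.inl rfl

/-- Induction on cubes from the coarse generations to the fine ones. -/
lemma Cube.induction_parent {p : Δ.Cube → Prop} (base : ∀ Q : Δ.Cube, j₀ ≤ Q.gen → p Q)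
    (step : ∀ Q : Δ.Cube, Q.gen < j₀ → p Q.parent → p Q) (Q : Δ.Cube) : p Q := by
  obtain ⟨k, hk⟩ : ∃ k : ℕ, (j₀ - Q.gen).toNat = k := ⟨_, rfl⟩
  induction k generalizing Q with
  | zero => exact base Q (by omega)
  | succ k ih => exact step Q (by omega) (ih _ (by rw [Cube.gen_parent]; omega))

lemma le_stoppingTop (Q : Δ.Cube) : Q ≤ stoppingTop good j₀ Q := by
  induction Q using Cube.induction_parent j₀ with
  | base Q h => rw [stoppingTop_of_le good j₀ h]; exact Q.le_refl
  | step Q h ih =>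
    rcases stoppingTop_eq_or good j₀ Q with h' | ⟨-, h', -⟩
    · rw [h']; exact Q.le_refl
    · rw [h']; exact Cube.le_trans Q.le_parent ih

lemma gen_stoppingTop_le {Q : Δ.Cube} (h : Q.gen ≤ j₀) : (stoppingTop good j₀ Q).gen ≤ j₀ := by
  induction Q using Cube.induction_parent j₀ with
  | base Q h' => rwa [stoppingTop_of_le good j₀ h']
  | step Q h' ih =>
    rcases stoppingTop_eq_or good j₀ Q with h'' | ⟨-, h'', -⟩
    · rwa [h'']
    · rw [h'']; exact ih (by rw [Cube.gen_parent]; omega)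

lemma stoppingTop_eq_of_le {Q Q' : Δ.Cube} (h : Q ≤ Q') (h' : Q' ≤ stoppingTop good j₀ Q) :
    stoppingTop good j₀ Q' = stoppingTop good j₀ Q := by
  induction Q using Cube.induction_parent j₀ with
  | base Q hQ =>
    rw [stoppingTop_of_le good j₀ hQ] at h'
    rw [Cube.eq_of_le h h'.1]
  | step Q hQ ih =>
    rcases h.1.eq_or_lt with hgen | hgen
    · rw [Cube.eq_of_le h hgen.ge]
    rcases stoppingTop_eq_or good j₀ Q with h'' | ⟨-, h'', -⟩
    · rw [h''] at h'
      exact absurd h'.1 (by omega)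
    · rw [h''] at h' ⊢
      exact ih (Cube.parent_le h hgen) h'

lemma stoppingTop_stoppingTop (Q : Δ.Cube) :
    stoppingTop good j₀ (stoppingTop good j₀ Q) = stoppingTop good j₀ Q :=
  stoppingTop_eq_of_le good j₀ (le_stoppingTop good j₀ Q) (Cube.le_refl _)

lemma stoppingTop_le {Q R : Δ.Cube} (hR : R.gen = j₀) (h : Q ≤ R) :
    stoppingTop good j₀ Q ≤ R :=
  Cube.le_of_le_of_le (le_stoppingTop good j₀ Q) h
    ((gen_stoppingTop_le good j₀ (hR ▸ h.1)).trans hR.ge)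

lemma good_of_stoppingTop_ne {Q : Δ.Cube} (h : stoppingTop good j₀ Q ≠ Q) :
    good (stoppingTop good j₀ Q) Q := by
  obtain ⟨-, h', hg⟩ := (stoppingTop_eq_or good j₀ Q).resolve_left h
  rw [h']
  exact hg Q Q.isChild_parent

lemma children_stoppingTop (Q : Δ.Cube) (hQ : Q.gen ≤ j₀) :
    (∀ Q' : Δ.Cube, IsChild Q' Q → stoppingTop good j₀ Q' = stoppingTop good j₀ Q) ∨
      ∀ Q' : Δ.Cube, IsChild Q' Q → stoppingTop good j₀ Q' ≠ stoppingTop good j₀ Q := by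
  have hlt : ∀ Q' : Δ.Cube, IsChild Q' Q → Q'.gen < j₀ := fun Q' h => by
    have := h.1
    omega
  by_cases hg : ∀ Q' : Δ.Cube, IsChild Q' Q → good (stoppingTop good j₀ Q) Q'
  · refine Or.inl fun Q' h => ?_
    rw [stoppingTop_of_lt good j₀ (hlt Q' h), Cube.parent_eq_of_isChild h, if_pos hg]
  · refine Or.inr fun Q' h heq => ?_
    rw [stoppingTop_of_lt good j₀ (hlt Q' h), Cube.parent_eq_of_isChild h, if_neg hg] at heq
    have h1 := (le_stoppingTop good j₀ Q).1
    rw [← heq] at h1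
    have := h.1
    omega

/-- The maximal cubes of the families that start right below the family with maximal cube `T`. -/
def nextTops (T : Δ.Cube) : Set Δ.Cube :=
  {Q | stoppingTop good j₀ Q = Q ∧ Q.gen < j₀ ∧ stoppingTop good j₀ Q.parent = T}

variable {good j₀}

lemma parent_le_of_mem_nextTops {T Q : Δ.Cube} (h : Q ∈ nextTops good j₀ T) : Q.parent ≤ T := by
  rw [← h.2.2]
  exact le_stoppingTop good j₀ Q.parent

lemma gen_lt_of_mem_nextTops {T Q : Δ.Cube} (h : Q ∈ nextTops good j₀ T) : Q.gen < T.gen := by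
  have := (parent_le_of_mem_nextTops h).1
  rw [Cube.gen_parent] at this
  omega

lemma exists_not_good_of_mem_nextTops {T Q : Δ.Cube} (h : Q ∈ nextTops good j₀ T) :
    ∃ Q' : Δ.Cube, IsChild Q' Q.parent ∧ ¬ good T Q' := by
  by_contra! hg
  have h1 := stoppingTop_of_lt good j₀ h.2.1
  rw [h.2.2, if_pos hg, h.1] at h1
  have := gen_lt_of_mem_nextTops h
  rw [h1] at this
  exact lt_irrefl _ this

lemma pairwiseDisjoint_nextTops (T : Δ.Cube) :
    (nextTops good j₀ T).PairwiseDisjoint Cube.carrier := by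
  have key : ∀ Q₁ ∈ nextTops good j₀ T, ∀ Q₂ ∈ nextTops good j₀ T, Q₁.gen ≤ Q₂.gen →
      Q₁ ≠ Q₂ → Disjoint Q₁.carrier Q₂.carrier := by
    intro Q₁ h₁ Q₂ h₂ hgen hne
    refine Set.disjoint_left.2 fun x hx hx' => ?_
    have hle := Cube.le_of_mem hgen hx hx'
    have hlt : Q₁.gen < Q₂.gen := by
      by_contra! h
      exact hne (Cube.eq_of_le hle h)
    have h3 : stoppingTop good j₀ Q₂ = stoppingTop good j₀ Q₁.parent := by
      refine stoppingTop_eq_of_le good j₀ (Cube.parent_le hle hlt) ?_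
      rw [h₁.2.2]
      exact Cube.le_trans Q₂.le_parent (parent_le_of_mem_nextTops h₂)
    rw [h₁.2.2, h₂.1] at h3
    have := gen_lt_of_mem_nextTops h₂
    rw [h3] at this
    exact lt_irrefl _ this
  intro Q₁ h₁ Q₂ h₂ hne
  rcases le_total Q₁.gen Q₂.gen with h | h
  · exact key Q₁ h₁ Q₂ h₂ h hne
  · exact (key Q₂ h₂ Q₁ h₁ h hne.symm).symm

/-- Going down from `R`, one leaves the family of `R` through one of its next maximal cubes. -/
lemma stoppingTop_eq_or_exists_nextTops {Q R : Δ.Cube} (hR : R.gen ≤ j₀) (h : Q ≤ R) :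
    stoppingTop good j₀ Q = stoppingTop good j₀ R ∨
      ∃ T ∈ nextTops good j₀ (stoppingTop good j₀ R), Q ≤ T ∧ T ≤ R ∧ T.gen < R.gen := by
  induction Q using Cube.induction_parent R.gen with
  | base Q hQ => exact Or.inl (by rw [Cube.eq_of_le h hQ])
  | step Q hQ ih =>
    rcases ih (Cube.parent_le h hQ) with h' | ⟨T, hT, hQT, hTR⟩
    · rcases stoppingTop_eq_or good j₀ Q with h'' | ⟨-, h'', -⟩
      · exact Or.inr ⟨Q, ⟨h'', by omega, h'⟩, Q.le_refl, h, hQ⟩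
      · exact Or.inl (h''.trans h')
    · exact Or.inr ⟨T, hT, Cube.le_trans Q.le_parent hQT, hTR⟩

/-- If the next maximal cubes below each `T` carry at most the proportion `ε / 2` of its measure,
then the sum over all maximal cubes is dominated by a geometric series. The induction is on the
number `k` of generations taken into account. -/
lemma tsum_tops_le_of_gen (hE : IsClosed E) {ε : ℝ} (hε : 0 < ε) (hε1 : ε ≤ 1) {R : Δ.Cube}
    (hR : R.gen = j₀)
    (hnext : ∀ T ≤ R, stoppingTop good j₀ T = T →
      ∑' Q : nextTops good j₀ T, normHausdorff n d Q.1.carrier ≤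
        ENNReal.ofReal (ε / 2) * normHausdorff n d T.carrier) (k : ℕ) {R' : Δ.Cube}
    (hR' : R' ≤ R) :
    ∑' T : {T : Δ.Cube | stoppingTop good j₀ T = T ∧ T ≤ R' ∧ R'.gen ≤ T.gen + k},
      normHausdorff n d T.1.carrier ≤ ENNReal.ofReal (1 + ε) * normHausdorff n d R'.carrier := by
  have hone : (1 : ℝ≥0∞) ≤ ENNReal.ofReal (1 + ε) := by
    rw [← ENNReal.ofReal_one]
    exact ENNReal.ofReal_le_ofReal (by linarith)
  induction k generalizing R' with
  | zero =>
    have hsub : {T : Δ.Cube | stoppingTop good j₀ T = T ∧ T ≤ R' ∧ R'.gen ≤ T.gen + (0 : ℕ)} ⊆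
        {R'} := fun T hT => Cube.eq_of_le hT.2.1 (by simpa using hT.2.2)
    refine (ENNReal.tsum_mono_subtype (fun T : Δ.Cube => normHausdorff n d T.carrier)
      hsub).trans ?_
    rw [tsum_singleton (f := fun T : Δ.Cube => normHausdorff n d T.carrier)]
    exact le_mul_of_one_le_left zero_le hone
  | succ k ih =>
    set T₀ := stoppingTop good j₀ R' with hT₀
    set 𝒯 : Set Δ.Cube := {T ∈ nextTops good j₀ T₀ | T ≤ R' ∧ T.gen < R'.gen} with h𝒯
    set B : Δ.Cube → Set Δ.Cube := fun T₁ =>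
      {T : Δ.Cube | stoppingTop good j₀ T = T ∧ T ≤ T₁ ∧ T₁.gen ≤ T.gen + k} with hB
    have hcov : ∀ T : Δ.Cube, stoppingTop good j₀ T = T → T ≤ R' →
        R'.gen ≤ T.gen + (k + 1 : ℕ) → T ≠ R' → T ∈ ⋃ T₁ ∈ 𝒯, B T₁ := by
      intro T h1 h2 h3 hne
      rcases stoppingTop_eq_or_exists_nextTops (hR'.1.trans hR.le) h2 with
        h | ⟨T₁, hT₁, h4, h5, h6⟩
      · rw [h1] at h
        have h7 := (le_stoppingTop good j₀ R').1
        rw [← h] at h7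
        exact absurd (Cube.eq_of_le h2 h7) hne
      · refine Set.mem_biUnion (x := T₁) ⟨hT₁, h5, h6⟩ ⟨h1, h4, ?_⟩
        push_cast at h3
        omega
    have hsum : ∑' T : ⋃ T₁ ∈ 𝒯, B T₁, normHausdorff n d T.1.carrier ≤
        ENNReal.ofReal (1 + ε) * ∑' T : 𝒯, normHausdorff n d T.1.carrier := by
      refine (ENNReal.tsum_biUnion_le_tsum (fun T : Δ.Cube => normHausdorff n d T.carrier)
        𝒯 B).trans ?_
      rw [← ENNReal.tsum_mul_left]
      exact ENNReal.tsum_le_tsum fun T => ih (Cube.le_trans T.2.2.1 hR')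
    by_cases htop : T₀ = R'
    · have hsub : {T : Δ.Cube | stoppingTop good j₀ T = T ∧ T ≤ R' ∧
          R'.gen ≤ T.gen + (k + 1 : ℕ)} ⊆ {R'} ∪ ⋃ T₁ ∈ 𝒯, B T₁ := by
        intro T hT
        by_cases hne : T = R'
        · exact Or.inl hne
        · exact Or.inr (hcov T hT.1 hT.2.1 hT.2.2 hne)
      refine (ENNReal.tsum_mono_subtype (fun T : Δ.Cube => normHausdorff n d T.carrier)
        hsub).trans ((ENNReal.tsum_union_le
          (fun T : Δ.Cube => normHausdorff n d T.carrier) _ _).trans ?_)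
      rw [tsum_singleton (f := fun T : Δ.Cube => normHausdorff n d T.carrier)]
      have hsub' : 𝒯 ⊆ nextTops good j₀ R' := fun T hT => htop ▸ hT.1
      have h1 : ∑' T : 𝒯, normHausdorff n d T.1.carrier ≤
          ENNReal.ofReal (ε / 2) * normHausdorff n d R'.carrier :=
        (ENNReal.tsum_mono_subtype (fun T : Δ.Cube => normHausdorff n d T.carrier)
          hsub').trans (hnext R' hR' (hT₀ ▸ htop))
      calc normHausdorff n d R'.carrier + ∑' T : ⋃ T₁ ∈ 𝒯, B T₁, normHausdorff n d T.1.carrier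
          ≤ normHausdorff n d R'.carrier + ENNReal.ofReal (1 + ε) *
            (ENNReal.ofReal (ε / 2) * normHausdorff n d R'.carrier) := by
            gcongr
            exact hsum.trans (by gcongr)
        _ = ENNReal.ofReal (1 + (1 + ε) * (ε / 2)) * normHausdorff n d R'.carrier := by
            rw [← mul_assoc, ← ENNReal.ofReal_mul (by positivity),
              ENNReal.ofReal_add zero_le_one (show 0 ≤ (1 + ε) * (ε / 2) by positivity),
              ENNReal.ofReal_one, add_mul (1 : ℝ≥0∞), one_mul]
        _ ≤ ENNReal.ofReal (1 + ε) * normHausdorff n d R'.carrier := by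
            gcongr
            nlinarith
    · have hsub : {T : Δ.Cube | stoppingTop good j₀ T = T ∧ T ≤ R' ∧
          R'.gen ≤ T.gen + (k + 1 : ℕ)} ⊆ ⋃ T₁ ∈ 𝒯, B T₁ := by
        intro T hT
        refine hcov T hT.1 hT.2.1 hT.2.2 ?_
        rintro rfl
        exact htop hT.1
      refine (ENNReal.tsum_mono_subtype (fun T : Δ.Cube => normHausdorff n d T.carrier)
        hsub).trans (hsum.trans ?_)
      gcongr
      exact Cube.tsum_measure_le hE ((pairwiseDisjoint_nextTops T₀).subset fun T hT => hT.1)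
        fun T hT => hT.2.1.2

lemma tsum_tops_le (hE : IsClosed E) {ε : ℝ} (hε : 0 < ε) (hε1 : ε ≤ 1) {R : Δ.Cube}
    (hR : R.gen = j₀)
    (hnext : ∀ T ≤ R, stoppingTop good j₀ T = T →
      ∑' Q : nextTops good j₀ T, normHausdorff n d Q.1.carrier ≤
        ENNReal.ofReal (ε / 2) * normHausdorff n d T.carrier) {R' : Δ.Cube} (hR' : R' ≤ R) :
    ∑' T : {T : Δ.Cube | stoppingTop good j₀ T = T ∧ T ≤ R'}, normHausdorff n d T.1.carrier ≤
      ENNReal.ofReal (1 + ε) * normHausdorff n d R'.carrier := by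
  rw [ENNReal.tsum_eq_iSup_sum]
  refine iSup_le fun s => ?_
  -- a finite set of cubes spans finitely many generations
  obtain ⟨k, hk⟩ : ∃ k : ℕ, ∀ T ∈ s, R'.gen ≤ T.1.gen + k := by
    refine ⟨s.sup fun T => (R'.gen - T.1.gen).toNat, fun T hT => ?_⟩
    have := Finset.le_sup (f := fun T : {T : Δ.Cube | stoppingTop good j₀ T = T ∧ T ≤ R'} =>
      (R'.gen - T.1.gen).toNat) hT
    omega
  refine le_trans ?_ (tsum_tops_le_of_gen hE hε hε1 hR hnext k hR')
  rw [← Finset.tsum_subtype s fun T => normHausdorff n d T.1.carrier]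
  exact ENNReal.tsum_comp_le_tsum_of_injective
    (f := fun T : {T // T ∈ s} => (⟨T.1.1, T.1.2.1, T.1.2.2, hk T.1 T.2⟩ :
      {T : Δ.Cube | stoppingTop good j₀ T = T ∧ T ≤ R' ∧ R'.gen ≤ T.gen + k}))
    (fun T T' h => Subtype.ext (Subtype.ext (congrArg (fun T => T.1) h)))
    (fun T => normHausdorff n d T.1.carrier)

end StoppingTime

end DyadicSystem

/-! ### Approximation by Lipschitz graphs -/

namespace DyadicSystem

variable {n d : ℕ} {E : Set (EuclideanSpace ℝ (Fin n))} {C : ℝ} {Δ : DyadicSystem d E C}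

/-- A point of one of the sets `E` and `Γ` that is at distance more than `s` from the other one is
the centre of a ball of radius `s` in which the two sets differ by a set of measure `≳ s ^ d`. -/
lemma le_measure_symmDiff {δ : ℝ} (hδ : δ ≤ 1) (hE : IsAhlforsRegular d (8 ^ d) E)
    {Γ : Set (EuclideanSpace ℝ (Fin n))} (hΓ : IsLipschitzGraph d δ Γ)
    {x : EuclideanSpace ℝ (Fin n)} (hx : x ∈ E ∪ Γ) {s : ℝ} (hs : 0 < s)
    (hlt : s < Metric.infDist x E + Metric.infDist x Γ) :
    ENNReal.ofReal ((s / 8) ^ d) ≤ normHausdorff n d (Metric.ball x s ∩ (E ∆ Γ)) := by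
  rcases hx with hx | hx
  · rw [Metric.infDist_zero_of_mem hx, zero_add] at hlt
    have h1 := (hE.2.2 x hx s hs).1
    rw [← inv_pow, ← mul_pow, inv_mul_eq_div] at h1
    refine h1.trans (measure_mono fun y hy => ⟨hy.2, Or.inl ⟨hy.1, fun hyΓ => ?_⟩⟩)
    have h2 := Metric.infDist_le_dist_of_mem (x := x) hyΓ
    have h3 := Metric.mem_ball'.1 hy.2
    linarith
  · rw [Metric.infDist_zero_of_mem hx, add_zero] at hlt
    have h1 := hΓ.le_measure_inter_ball hδ hx hs
    have h0 : ENNReal.ofReal ((s / 8) ^ d) ≤ ENNReal.ofReal ((s / 2) ^ d) :=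
      ENNReal.ofReal_le_ofReal (by gcongr; norm_num)
    refine h0.trans (h1.trans (measure_mono fun y hy => ⟨hy.2, Or.inr ⟨hy.1, fun hyE => ?_⟩⟩))
    have h2 := Metric.infDist_le_dist_of_mem (x := x) hyE
    have h3 := Metric.mem_ball'.1 hy.2
    linarith

/-- `Γ` is a Lipschitz graph that approximates `E` at the scale `M` times the size of the
cube `T`. -/
def IsApproxGraph (Δ : DyadicSystem d E C) (δ M : ℝ) (T : Δ.Cube)
    (Γ : Set (EuclideanSpace ℝ (Fin n))) : Prop :=
  IsLipschitzGraph d δ Γ ∧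
    normHausdorff n d (Metric.ball (Δ.center T.carrier) (M * 2 ^ T.gen) ∩ (E ∆ Γ)) ≤
      ENNReal.ofReal (δ * (2 * M * 2 ^ T.gen) ^ d)

/-- One graph serves all the cubes of a generation near a given one. -/
lemma exists_isApproxGraph {δ : ℝ} (hE : IsDeltaUR d δ E) {M : ℝ} (hM : 0 < M) (R₀ : Δ.Cube) :
    ∃ Γ, ∀ R : Δ.Cube, R.gen = R₀.gen →
      dist (Δ.center R.carrier) (Δ.center R₀.carrier) ≤ M * 2 ^ R₀.gen →
      IsApproxGraph Δ δ M R Γ := by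
  obtain ⟨Γ, hΓ, hm, -⟩ := hE.2.2.2 _ (R₀.carrier_subset R₀.center_mem) (2 * M * 2 ^ R₀.gen)
    (by positivity)
  refine ⟨Γ, fun R hR hdist => ⟨hΓ, ?_⟩⟩
  rw [hR]
  refine le_trans (measure_mono (Set.inter_subset_inter_left _ ?_)) hm
  refine Metric.ball_subset_ball' ?_
  linarith

/-- The cube `Q` is good for the graph `Γ`: near `Q`, the sets `E` and `Γ` are close at the scale
of `Q`. -/
def IsGood (Δ : DyadicSystem d E C) (ε : ℝ) (Γ : Set (EuclideanSpace ℝ (Fin n)))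
    (Q : Δ.Cube) : Prop :=
  ∀ x ∈ dilBall ε⁻¹ Q ∩ (E ∪ Γ),
    Metric.infDist x E + Metric.infDist x Γ ≤ ε * Metric.diam Q.carrier

variable {δ ε K : ℝ}

/-- Around a cube that is not good, the symmetric difference of `E` and `Γ` fills a proportion
`≳ ε ^ (2 * d)` of a ball of radius `≈ ε⁻¹` times its size. -/
lemma le_measure_symmDiff_of_not_isGood (hK : C ≤ K) (hε : 0 < ε) (hε1 : ε ≤ 1 / 2) (hδ : δ ≤ 1)
    (hE : IsAhlforsRegular d (8 ^ d) E) {Γ : Set (EuclideanSpace ℝ (Fin n))}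
    (hΓ : IsLipschitzGraph d δ Γ) {Q Q' : Δ.Cube} (hgen : Q'.gen = Q.gen)
    (hdist : dist (Δ.center Q'.carrier) (Δ.center Q.carrier) ≤ 2 * K * 2 ^ Q.gen)
    (hbad : ¬ IsGood Δ ε Γ Q') :
    ENNReal.ofReal ((ε * 2 ^ Q.gen / (8 * K)) ^ d) ≤
      normHausdorff n d (Metric.ball (Δ.center Q.carrier) (4 * K * ε⁻¹ * 2 ^ Q.gen) ∩ (E ∆ Γ)) := by
  have hK1 : 1 ≤ K := Δ.one_le.trans hK
  have hl : (0 : ℝ) < 2 ^ Q.gen := by positivity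
  simp only [IsGood, not_forall, not_le] at hbad
  obtain ⟨x, ⟨hxball, hx⟩, hlt⟩ := hbad
  have hd0 := Q'.diam_pos
  have hd1 := Q'.diam_le hK
  have hd2 := Q'.le_diam hK
  rw [hgen] at hd1 hd2
  have h1 := le_measure_symmDiff hδ hE hΓ hx (by positivity) hlt
  refine le_trans (ENNReal.ofReal_le_ofReal ?_) (h1.trans (measure_mono
    (Set.inter_subset_inter_left _ (Metric.ball_subset_ball' ?_))))
  · refine pow_le_pow_left₀ (by positivity) ?_ d
    calc ε * 2 ^ Q.gen / (8 * K) = ε * (K⁻¹ * 2 ^ Q.gen) / 8 := by field_simp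
      _ ≤ ε * Metric.diam Q'.carrier / 8 := by gcongr
  · have h2 : dist x (Δ.center Q'.carrier) ≤ ε⁻¹ * (K * 2 ^ Q.gen) := by
      have := Metric.mem_ball.1 hxball
      refine this.le.trans ?_
      gcongr
    have h3 := dist_triangle x (Δ.center Q'.carrier) (Δ.center Q.carrier)
    have h4 : 2 ≤ ε⁻¹ := by
      rw [le_inv_comm₀ (by norm_num) hε]
      linarith
    have h5 : ε * Metric.diam Q'.carrier ≤ 1 * (K * 2 ^ Q.gen) := by
      gcongr
      linarith
    have h6 : 0 < K * 2 ^ Q.gen := by positivity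
    have h7 : 2 * (K * 2 ^ Q.gen) ≤ ε⁻¹ * (K * 2 ^ Q.gen) := by gcongr
    calc ε * Metric.diam Q'.carrier + dist x (Δ.center Q.carrier)
        ≤ 3 * (K * 2 ^ Q.gen) + ε⁻¹ * (K * 2 ^ Q.gen) := by linarith
      _ ≤ 4 * (ε⁻¹ * (K * 2 ^ Q.gen)) := by linarith
      _ = _ := by ring

/-- The smallness of `δ` with respect to `ε` from which all the estimates follow, for a dyadic
system of constant at most `K`. The power `ε ^ (3 * d)` pays for the size `≈ ε⁻¹` of the balls that
define goodness, for the size `≈ ε` of the balls in which a bad cube is detected, and for the scale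
`≈ ε⁻¹` at which the graphs approximate; the remaining `ε` is the gain. -/
def IsSmallParam (d : ℕ) (K δ ε : ℝ) : Prop :=
  1 ≤ K ∧ 0 < δ ∧ 0 < ε ∧ ε ≤ 1 / 2 ∧ δ ≤ ε ∧ 2 * K * (18432 * K ^ 3) ^ d * δ ≤ ε ^ (3 * d + 1)

lemma IsSmallParam.mul_le (hp : IsSmallParam d K δ ε) :
    (1536 * K ^ 2 * ε⁻¹ ^ 2) ^ d * (δ * (12 * K * ε⁻¹) ^ d) ≤ ε / (2 * K) := by
  obtain ⟨hK1, hδ, hε, hε1, hδε, hsmall⟩ := hp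
  have h1 : (1536 * K ^ 2 * ε⁻¹ ^ 2) ^ d * (δ * (12 * K * ε⁻¹) ^ d) =
      (18432 * K ^ 3) ^ d * δ / ε ^ (3 * d) := by
    rw [mul_left_comm, ← mul_pow, pow_mul, mul_comm ((18432 * K ^ 3) ^ d), mul_div_assoc,
      ← div_pow]
    congr 2
    field_simp
    norm_num
  rw [h1, div_le_div_iff₀ (by positivity) (by positivity)]
  calc (18432 * K ^ 3) ^ d * δ * (2 * K) = 2 * K * (18432 * K ^ 3) ^ d * δ := by ring
    _ ≤ ε ^ (3 * d + 1) := hsmall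
    _ = ε * ε ^ (3 * d) := pow_succ' _ _

lemma IsSmallParam.one_le_inv (hp : IsSmallParam d K δ ε) : 1 ≤ ε⁻¹ := by
  obtain ⟨hK1, hδ, hε, hε1, hδε, hsmall⟩ := hp
  exact (one_le_inv₀ hε).2 (by linarith)

lemma IsSmallParam.delta_mul_le (hp : IsSmallParam d K δ ε) :
    δ * (12 * K * ε⁻¹) ^ d ≤ ε / (2 * K) := by
  have h0 := hp.one_le_inv
  have hK1 := hp.1
  have hδ := hp.2.1
  refine le_trans (le_mul_of_one_le_left (by positivity) (one_le_pow₀ ?_)) hp.mul_le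
  have h1 : 1 ≤ K ^ 2 := one_le_pow₀ hK1
  have h2 : 1 ≤ ε⁻¹ ^ 2 := one_le_pow₀ h0
  nlinarith

lemma IsApproxGraph.isGood (hK : C ≤ K) (hp : IsSmallParam d K δ ε)
    (hE : IsAhlforsRegular d (8 ^ d) E) {Γ : Set (EuclideanSpace ℝ (Fin n))} {T : Δ.Cube}
    (hT : IsApproxGraph Δ δ (6 * K * ε⁻¹) T Γ) : IsGood Δ ε Γ T := by
  by_contra hbad
  have hkey := hp.mul_le
  have hinv := hp.one_le_inv
  obtain ⟨hK1, hδ, hε, hε1, hδε, -⟩ := hp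
  have hl : (0 : ℝ) < 2 ^ T.gen := by positivity
  have h1 := le_measure_symmDiff_of_not_isGood (Q := T) hK hε hε1 (by linarith) hE hT.1 rfl
    (by rw [dist_self]; positivity) hbad
  have h2 := h1.trans ((measure_mono (Set.inter_subset_inter_left _
    (Metric.ball_subset_ball (by gcongr; norm_num)))).trans hT.2)
  rw [ENNReal.ofReal_le_ofReal_iff (by positivity)] at h2
  have h3 : (2 * (6 * K * ε⁻¹) * 2 ^ T.gen) ^ d =
      (96 * K ^ 2 * ε⁻¹ ^ 2) ^ d * (ε * 2 ^ T.gen / (8 * K)) ^ d := by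
    rw [← mul_pow]
    congr 1
    field_simp
    norm_num
  rw [h3, ← mul_assoc] at h2
  have h4 : 1 ≤ δ * (96 * K ^ 2 * ε⁻¹ ^ 2) ^ d := by
    have hpos : 0 < (ε * 2 ^ T.gen / (8 * K)) ^ d := by positivity
    exact le_of_mul_le_mul_right (by rwa [one_mul]) hpos
  have h5 : δ * (96 * K ^ 2 * ε⁻¹ ^ 2) ^ d ≤
      (1536 * K ^ 2 * ε⁻¹ ^ 2) ^ d * (δ * (12 * K * ε⁻¹) ^ d) := by
    rw [mul_comm δ]
    gcongr
    · norm_num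
    · refine le_mul_of_one_le_right hδ.le (one_le_pow₀ ?_)
      nlinarith
  have h6 : ε / (2 * K) < 1 := by
    rw [div_lt_one (by positivity)]
    linarith
  linarith

lemma IsApproxGraph.measure_le (hK : C ≤ K) (hp : IsSmallParam d K δ ε)
    {Γ : Set (EuclideanSpace ℝ (Fin n))} {T : Δ.Cube}
    (hT : IsApproxGraph Δ δ (6 * K * ε⁻¹) T Γ) :
    normHausdorff n d (dilBall ε⁻¹ T ∩ (E ∆ Γ)) ≤
      ENNReal.ofReal ε * normHausdorff n d T.carrier := by
  have hkey := hp.delta_mul_le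
  have hinv := hp.one_le_inv
  obtain ⟨hK1, hδ, hε, hε1, hδε, -⟩ := hp
  have hl : (0 : ℝ) < 2 ^ T.gen := by positivity
  have hsub : dilBall ε⁻¹ T ⊆ Metric.ball (Δ.center T.carrier) (6 * K * ε⁻¹ * 2 ^ T.gen) := by
    refine Metric.ball_subset_ball ?_
    have h1 : ε⁻¹ * Metric.diam T.carrier ≤ ε⁻¹ * (K * 2 ^ T.gen) := by
      gcongr
      exact T.diam_le hK
    have h2 : 0 < ε⁻¹ * (K * 2 ^ T.gen) := by positivity
    linarith
  calc normHausdorff n d (dilBall ε⁻¹ T ∩ (E ∆ Γ))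
      ≤ ENNReal.ofReal (δ * (2 * (6 * K * ε⁻¹) * 2 ^ T.gen) ^ d) :=
        (measure_mono (Set.inter_subset_inter_left _ hsub)).trans hT.2
    _ ≤ ENNReal.ofReal (ε * (K⁻¹ * (2 ^ T.gen) ^ d)) := by
        refine ENNReal.ofReal_le_ofReal ?_
        rw [show 2 * (6 * K * ε⁻¹) * 2 ^ T.gen = 12 * K * ε⁻¹ * 2 ^ T.gen by ring, mul_pow _ _ d,
          ← mul_assoc, ← mul_assoc]
        refine mul_le_mul_of_nonneg_right (hkey.trans ?_) (by positivity)
        rw [← div_eq_mul_inv]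
        gcongr
        linarith
    _ ≤ ENNReal.ofReal ε * normHausdorff n d T.carrier := by
        rw [ENNReal.ofReal_mul hε.le]
        gcongr
        exact T.le_measure hK

/-- By the Vitali covering lemma, disjoint subcubes of `T` around which `E` and the graph of `T`
differ substantially carry a small proportion of the measure of `T`. -/
lemma IsApproxGraph.tsum_measure_le (hK : C ≤ K) (hp : IsSmallParam d K δ ε)
    (hE : IsAhlforsRegular d (8 ^ d) E) {Γ : Set (EuclideanSpace ℝ (Fin n))} {T : Δ.Cube}
    (hT : IsApproxGraph Δ δ (6 * K * ε⁻¹) T Γ) {𝒬 : Set Δ.Cube}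
    (hdisj : 𝒬.PairwiseDisjoint Cube.carrier) (hle : ∀ Q ∈ 𝒬, Q ≤ T)
    (hbad : ∀ Q ∈ 𝒬, ENNReal.ofReal ((ε * 2 ^ Q.gen / (8 * K)) ^ d) ≤
      normHausdorff n d
        (Metric.ball (Δ.center Q.carrier) (4 * K * ε⁻¹ * 2 ^ Q.gen) ∩ (E ∆ Γ))) :
    ∑' Q : 𝒬, normHausdorff n d Q.1.carrier ≤
      ENNReal.ofReal (ε / 2) * normHausdorff n d T.carrier := by
  have hkey := hp.mul_le
  have hinv := hp.one_le_inv
  obtain ⟨hK1, hδ, hε, hε1, hδε, -⟩ := hp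
  set ρ : ℝ := 4 * K * ε⁻¹ with hρ
  have hρ0 : 0 < ρ := by positivity
  set N : ℝ := (1536 * K ^ 2 * ε⁻¹ ^ 2) ^ d with hN
  have hpow : ∀ Q ∈ 𝒬, (2 : ℝ) ^ Q.gen ≤ 2 ^ T.gen := fun Q hQ =>
    zpow_le_zpow_right₀ (by norm_num) (hle Q hQ).1
  -- the balls of radius `ρ` times the size of a cube contain the cube and the bad set around it
  obtain ⟨u, hu, hudisj, hucov⟩ := Vitali.exists_disjoint_subfamily_covering_enlargement_closedBall
    𝒬 (fun Q => Δ.center Q.carrier) (fun Q => ρ * 2 ^ Q.gen) (ρ * 2 ^ T.gen)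
    (fun Q hQ => mul_le_mul_of_nonneg_left (hpow Q hQ) hρ0.le) 5 (by norm_num)
  have hucount : u.Countable := by
    refine hudisj.countable_of_nonempty_interior fun Q _ => ?_
    rw [interior_closedBall _ (by positivity)]
    exact Metric.nonempty_ball.2 (by positivity)
  have hcov : ⋃ Q ∈ 𝒬, Q.carrier ⊆
      ⋃ b ∈ u, E ∩ Metric.ball (Δ.center b.carrier) (6 * (ρ * 2 ^ b.gen)) := by
    refine Set.iUnion₂_subset fun Q hQ x hx => ?_
    obtain ⟨b, hb, hsub⟩ := hucov Q hQ
    refine Set.mem_biUnion hb ⟨Q.carrier_subset hx, ?_⟩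
    have hlb : (0 : ℝ) < ρ * 2 ^ b.gen := by positivity
    refine Metric.closedBall_subset_ball (by linarith) (hsub ?_)
    refine (Q.dist_le hK hx Q.center_mem).trans ?_
    gcongr
    nlinarith
  have hball : ∀ b ∈ u, normHausdorff n d
      (E ∩ Metric.ball (Δ.center b.carrier) (6 * (ρ * 2 ^ b.gen))) ≤ ENNReal.ofReal N *
      normHausdorff n d (Metric.ball (Δ.center b.carrier) (ρ * 2 ^ b.gen) ∩ (E ∆ Γ)) := by
    intro b hb
    refine (hE.2.2 _ (b.carrier_subset b.center_mem) _ (by positivity)).2.trans ?_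
    refine le_trans (le_of_eq ?_) (mul_le_mul_right (hbad b (hu hb)) _)
    rw [← ENNReal.ofReal_mul (by positivity), hN, ← mul_pow, ← mul_pow]
    congr 2
    rw [hρ]
    field_simp
    norm_num
  have hmeas : MeasurableSet (E ∆ Γ) :=
    hE.1.measurableSet.symmDiff (hT.1.isClosed (by linarith)).measurableSet
  have hin : ⋃ b ∈ u, Metric.ball (Δ.center b.carrier) (ρ * 2 ^ b.gen) ∩ (E ∆ Γ) ⊆
      Metric.ball (Δ.center T.carrier) (6 * K * ε⁻¹ * 2 ^ T.gen) ∩ (E ∆ Γ) := by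
    refine Set.iUnion₂_subset fun b hb => Set.inter_subset_inter_left _ ?_
    refine Metric.ball_subset_ball' ?_
    have h1 := T.dist_le hK ((hle b (hu hb)).2 b.center_mem) T.center_mem
    have h2 := hpow b (hu hb)
    have hl : (0 : ℝ) < K * 2 ^ T.gen := by positivity
    have h3 : 1 * (K * 2 ^ T.gen) ≤ ε⁻¹ * (K * 2 ^ T.gen) := by gcongr
    have h4 : ρ * 2 ^ b.gen ≤ 4 * (ε⁻¹ * (K * 2 ^ T.gen)) := by
      calc ρ * 2 ^ b.gen ≤ ρ * 2 ^ T.gen := by gcongr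
        _ = _ := by rw [hρ]; ring
    linarith
  calc ∑' Q : 𝒬, normHausdorff n d Q.1.carrier
      ≤ normHausdorff n d (⋃ Q ∈ 𝒬, Q.carrier) :=
        Cube.tsum_measure_le hE.1 hdisj fun Q hQ => Set.subset_biUnion_of_mem hQ
    _ ≤ ∑' b : u, normHausdorff n d
        (E ∩ Metric.ball (Δ.center b.1.carrier) (6 * (ρ * 2 ^ b.1.gen))) :=
        (measure_mono hcov).trans (measure_biUnion_le _ hucount _)
    _ ≤ ∑' b : u, ENNReal.ofReal N * normHausdorff n d
        (Metric.ball (Δ.center b.1.carrier) (ρ * 2 ^ b.1.gen) ∩ (E ∆ Γ)) :=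
        ENNReal.tsum_le_tsum fun b => hball b.1 b.2
    _ = ENNReal.ofReal N * normHausdorff n d
        (⋃ b ∈ u, Metric.ball (Δ.center b.carrier) (ρ * 2 ^ b.gen) ∩ (E ∆ Γ)) := by
        rw [ENNReal.tsum_mul_left, measure_biUnion hucount]
        · exact hudisj.mono fun b =>
            Set.inter_subset_left.trans Metric.ball_subset_closedBall
        · exact fun b _ => Metric.isOpen_ball.measurableSet.inter hmeas
    _ ≤ ENNReal.ofReal N * ENNReal.ofReal (δ * (2 * (6 * K * ε⁻¹) * 2 ^ T.gen) ^ d) := by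
        gcongr
        exact (measure_mono hin).trans hT.2
    _ ≤ ENNReal.ofReal (ε / 2 * (K⁻¹ * (2 ^ T.gen) ^ d)) := by
        rw [← ENNReal.ofReal_mul (by positivity)]
        refine ENNReal.ofReal_le_ofReal ?_
        rw [show 2 * (6 * K * ε⁻¹) * 2 ^ T.gen = 12 * K * ε⁻¹ * 2 ^ T.gen by ring, mul_pow _ _ d,
          ← mul_assoc, ← mul_assoc, ← mul_assoc]
        refine mul_le_mul_of_nonneg_right ?_ (by positivity)
        rw [mul_assoc]
        refine hkey.trans (le_of_eq ?_)
        field_simp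
    _ ≤ ENNReal.ofReal (ε / 2) * normHausdorff n d T.carrier := by
        rw [ENNReal.ofReal_mul (by positivity)]
        gcongr
        exact T.le_measure hK

end DyadicSystem

/-! ### Corona decompositions -/

namespace DyadicSystem

variable {n d : ℕ} {E : Set (EuclideanSpace ℝ (Fin n))} {C : ℝ} {Δ : DyadicSystem d E C}
  {δ ε K : ℝ}

/-- The stopping-time families with maximal cubes in `R` form a Corona partition, as soon as all
these maximal cubes `T` have approximating graphs `G T`. -/
lemma isCoronaPartition_of_isApproxGraph (hK : C ≤ K) (hp : IsSmallParam d K δ ε)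
    (hE : IsAhlforsRegular d (8 ^ d) E) {R : Δ.Cube}
    {G : Δ.Cube → Set (EuclideanSpace ℝ (Fin n))}
    (hG : ∀ T ≤ R, IsApproxGraph Δ δ (6 * K * ε⁻¹) T (G T)) {top : Set Δ.Cube → Δ.Cube}
    (htop : ∀ T, stoppingTop (fun T Q => IsGood Δ ε (G T) Q) R.gen T = T →
      top {Q | stoppingTop (fun T Q => IsGood Δ ε (G T) Q) R.gen Q = T} = T) :
    Δ.IsCoronaPartition ε R
      ((fun T => {Q | stoppingTop (fun T Q => IsGood Δ ε (G T) Q) R.gen Q = T}) ''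
        {T | stoppingTop (fun T Q => IsGood Δ ε (G T) Q) R.gen T = T ∧ T ≤ R})
      top (fun S => G (top S)) := by
  have hε := hp.2.2.1
  have hε1 := hp.2.2.2.1
  have hδε := hp.2.2.2.2.1
  set good : Δ.Cube → Δ.Cube → Prop := fun T Q => IsGood Δ ε (G T) Q with hgood
  refine ⟨?_, ?_, ?_, ?_, ?_, ?_, ?_, ?_, ?_⟩
  · ext Q
    simp only [Set.sUnion_image, Set.mem_iUnion, Set.mem_ofPred_eq, exists_prop]
    constructor
    · rintro ⟨T, ⟨-, hTR⟩, hQ⟩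
      exact Cube.le_trans (hQ ▸ le_stoppingTop good R.gen Q) hTR
    · exact fun hQ => ⟨stoppingTop good R.gen Q,
        ⟨stoppingTop_stoppingTop good R.gen Q, stoppingTop_le good R.gen rfl hQ⟩, rfl⟩
  · rintro _ ⟨T, hT, rfl⟩ _ ⟨T', hT', rfl⟩ hne
    refine Set.disjoint_left.2 fun Q hQ hQ' => hne ?_
    have : T = T' := hQ.symm.trans hQ'
    rw [this]
  · rintro _ ⟨T, hT, rfl⟩
    dsimp only
    rw [htop T hT.1]
    refine ⟨hT.1, fun Q hQ => ?_⟩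
    rw [← show stoppingTop good R.gen Q = T from hQ]
    exact le_stoppingTop good R.gen Q
  · rintro _ ⟨T, hT, rfl⟩ Q hQ Q' - hQQ' hQ'
    dsimp only at hQ'
    rw [htop T hT.1] at hQ'
    have hQT : stoppingTop good R.gen Q = T := hQ
    exact (stoppingTop_eq_of_le good R.gen hQQ' (hQT ▸ hQ')).trans hQT
  · rintro _ ⟨T, hT, rfl⟩ Q hQ
    have hQT : stoppingTop good R.gen Q = T := hQ
    have hgen : Q.gen ≤ R.gen := by
      have h := le_stoppingTop good R.gen Q
      rw [hQT] at h
      exact h.1.trans hT.2.1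
    rw [← hQT]
    exact children_stoppingTop good R.gen Q hgen
  · rintro _ ⟨T, hT, rfl⟩
    dsimp only
    rw [htop T hT.1]
    exact (hG T hT.2).1.mono hδε
  · rintro _ ⟨T, hT, rfl⟩
    dsimp only
    rw [htop T hT.1]
    exact (hG T hT.2).measure_le hK hp
  · rintro _ ⟨T, hT, rfl⟩ Q hQ
    dsimp only
    rw [htop T hT.1]
    have hQT : stoppingTop good R.gen Q = T := hQ
    by_cases h : Q = T
    · rw [h]
      exact (hG T hT.2).isGood hK hp hE
    · have hne : stoppingTop good R.gen Q ≠ Q := fun h' => h (h'.symm.trans hQT)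
      have hg := good_of_stoppingTop_ne good R.gen hne
      rw [hQT] at hg
      exact hg
  · intro R' hR'
    have hnext : ∀ T ≤ R, stoppingTop good R.gen T = T →
        ∑' Q : nextTops good R.gen T, normHausdorff n d Q.1.carrier ≤
          ENNReal.ofReal (ε / 2) * normHausdorff n d T.carrier := by
      intro T hT _
      refine (hG T hT).tsum_measure_le hK hp hE (pairwiseDisjoint_nextTops T)
        (fun Q hQ => Cube.le_trans Q.le_parent (parent_le_of_mem_nextTops hQ)) fun Q hQ => ?_
      obtain ⟨Q', hQ', hbad⟩ := exists_not_good_of_mem_nextTops hQ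
      have hgen : Q'.gen = Q.gen := by
        have := hQ'.1
        rw [Cube.gen_parent] at this
        omega
      refine le_measure_symmDiff_of_not_isGood hK hε hε1 (by linarith) hE (hG T hT).1 hgen ?_ hbad
      have hd := Q.parent.dist_le hK (hQ'.2 Q'.center_mem) (Q.le_parent.2 Q.center_mem)
      rw [Cube.gen_parent, zpow_add_one₀ (by norm_num)] at hd
      linarith
    refine le_trans ?_ (tsum_tops_le hE.1 hε (by linarith) rfl hnext hR')
    have hmem : ∀ S : {S : Set Δ.Cube // S ∈ (fun T => {Q | stoppingTop good R.gen Q = T}) ''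
        {T | stoppingTop good R.gen T = T ∧ T ≤ R} ∧ top S ≤ R'},
        stoppingTop good R.gen (top S.1) = top S.1 ∧
          S.1 = {Q | stoppingTop good R.gen Q = top S.1} := by
      rintro ⟨_, ⟨T, hT, rfl⟩, hle⟩
      dsimp only
      rw [htop T hT.1]
      exact ⟨hT.1, rfl⟩
    refine ENNReal.tsum_comp_le_tsum_of_injective
      (f := fun S : {S : Set Δ.Cube // S ∈ (fun T => {Q | stoppingTop good R.gen Q = T}) ''
        {T | stoppingTop good R.gen T = T ∧ T ≤ R} ∧ top S ≤ R'} =>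
        (⟨top S.1, (hmem S).1, S.2.2⟩ :
          {T : Δ.Cube | stoppingTop good R.gen T = T ∧ T ≤ R'}))
      (fun S S' h => Subtype.ext ?_) (fun T => normHausdorff n d T.1.carrier)
    have h' : top S.1 = top S'.1 := congrArg Subtype.val h
    rw [(hmem S).2, (hmem S').2, h']

/-- The cubes `R` of the generation of `R₀` start their families with a common graph; the families
are the fibres of a single map `stoppingTop`, so that the graph of a family is the one chosen for
its maximal cube. -/
theorem admitsCorona_of_isDeltaUR (hK : C ≤ K) (hp : IsSmallParam d K δ ε)
    (hUR : IsDeltaUR d δ E) (hE : IsAhlforsRegular d (8 ^ d) E) : Δ.AdmitsCorona ε := by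
  classical
  intro R₀
  have hinv := hp.one_le_inv
  have hε := hp.2.2.1
  have hε1 := hp.2.2.2.1
  have hK1 := hp.1
  have hM : 0 < 6 * K * ε⁻¹ := by positivity
  choose G₁ hG₁ using fun T : Δ.Cube => exists_isApproxGraph hUR hM T
  let G : Δ.Cube → Set (EuclideanSpace ℝ (Fin n)) := fun T =>
    if T.gen = R₀.gen then G₁ R₀ else G₁ T
  let t : Δ.Cube → Δ.Cube := stoppingTop (fun T Q => IsGood Δ ε (G T) Q) R₀.gen
  let top : Set Δ.Cube → Δ.Cube := fun S => if h : S.Nonempty then t h.some else R₀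
  have htop : ∀ T, t T = T → top {Q | t Q = T} = T := by
    intro T hT
    have h : {Q | t Q = T}.Nonempty := ⟨T, hT⟩
    simp only [top]
    rw [dif_pos h]
    exact h.some_mem
  have hl : (0 : ℝ) < 2 ^ R₀.gen := by positivity
  have htop_of_mem : ∀ R : Δ.Cube, R.gen = R₀.gen →
      ∀ S ∈ (fun T => {Q | t Q = T}) '' {T | t T = T ∧ T ≤ R}, R ∈ S → G (top S) = G₁ R₀ := by
    rintro R hR _ ⟨T, hT, rfl⟩ hRS
    have h1 : t R = T := hRS
    have h2 : t R = R := stoppingTop_of_le _ _ hR.ge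
    dsimp only
    rw [htop T hT.1, ← h1, h2]
    exact if_pos hR
  refine ⟨fun R => (fun T => {Q | t Q = T}) '' {T | t T = T ∧ T ≤ R}, top, fun S => G (top S),
    fun R hR hsub => ⟨?_, fun S hS hRS S₀ hS₀ hRS₀ => ?_⟩⟩
  · have hG : ∀ T ≤ R, IsApproxGraph Δ δ (6 * K * ε⁻¹) T (G T) := by
      intro T hT
      by_cases hgen : T.gen = R₀.gen
      · rw [show G T = G₁ R₀ from if_pos hgen]
        refine hG₁ R₀ T hgen ?_
        have h1 := Metric.mem_ball.1 (hsub (hT.2 T.center_mem))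
        have h2 : ε⁻¹ * Metric.diam R₀.carrier ≤ ε⁻¹ * (K * 2 ^ R₀.gen) := by
          gcongr
          exact R₀.diam_le hK
        have h3 : 0 < ε⁻¹ * (K * 2 ^ R₀.gen) := by positivity
        linarith
      · rw [show G T = G₁ T from if_neg hgen]
        refine hG₁ T T rfl ?_
        rw [dist_self]
        positivity
    have := isCoronaPartition_of_isApproxGraph hK hp hE hG (top := top) (by rw [hR]; exact htop)
    rw [hR] at this
    exact this
  · dsimp only
    rw [htop_of_mem R hR S hS hRS, htop_of_mem R₀ rfl S₀ hS₀ hRS₀]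

end DyadicSystem

/-- With the exponent `1 / (3 * d + 1)`, the number `ε = C₀ * δ ^ θ₀` satisfies
`ε ^ (3 * d + 1) = C₀ ^ (3 * d + 1) * δ`. -/
lemma isSmallParam_rpow (d : ℕ) (hd : 0 < d) {K : ℝ} (hK : 1 ≤ K) :
    ∃ C₀ δ₀ θ₀ : ℝ, 1 ≤ C₀ ∧ 0 < δ₀ ∧ 0 < θ₀ ∧ θ₀ < 1 ∧ δ₀ ≤ (1 / 8) ^ d ∧
      ∀ δ : ℝ, 0 < δ → δ < δ₀ → DyadicSystem.IsSmallParam d K δ (C₀ * δ ^ θ₀) := by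
  set C₀ : ℝ := 2 * K * (18432 * K ^ 3) ^ d with hC₀
  have hC1 : 1 ≤ C₀ := by
    have h1 : (1 : ℝ) ≤ (18432 * K ^ 3) ^ d :=
      one_le_pow₀ (by nlinarith [one_le_pow₀ (n := 3) hK])
    nlinarith
  set m : ℕ := 3 * d + 1 with hm
  have hm1 : (1 : ℝ) < m := by
    rw [hm]
    push_cast
    have : (1 : ℝ) ≤ d := by exact_mod_cast hd
    linarith
  have hm0 : (0 : ℝ) < m := by linarith
  refine ⟨C₀, min ((1 / 8) ^ d) ((2 * C₀)⁻¹ ^ m), (m : ℝ)⁻¹, hC1, by positivity, by positivity,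
    inv_lt_one_of_one_lt₀ hm1, min_le_left _ _, fun δ hδ hδ₀ => ?_⟩
  have hδ1 : δ ≤ 1 :=
    hδ₀.le.trans ((min_le_left _ _).trans (pow_le_one₀ (by norm_num) (by norm_num)))
  have hpow : (δ ^ (m : ℝ)⁻¹) ^ m = δ := Real.rpow_inv_natCast_pow hδ.le (by omega)
  have hpos : 0 < δ ^ (m : ℝ)⁻¹ := Real.rpow_pos_of_pos hδ _
  refine ⟨hK, hδ, by positivity, ?_, ?_, ?_⟩
  · have h1 : δ ^ (m : ℝ)⁻¹ ≤ (2 * C₀)⁻¹ := by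
      refine le_of_pow_le_pow_left₀ (n := m) (by omega) (by positivity) ?_
      rw [hpow]
      exact hδ₀.le.trans (min_le_right _ _)
    calc C₀ * δ ^ (m : ℝ)⁻¹ ≤ C₀ * (2 * C₀)⁻¹ := by gcongr
      _ = 1 / 2 := by field_simp
  · have h1 : δ ≤ δ ^ (m : ℝ)⁻¹ := by
      calc δ = δ ^ (1 : ℝ) := (Real.rpow_one δ).symm
        _ ≤ δ ^ (m : ℝ)⁻¹ := Real.rpow_le_rpow_of_exponent_ge hδ hδ1
          (inv_le_one_of_one_le₀ hm1.le)
    exact h1.trans (le_mul_of_one_le_left hpos.le hC1)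
  · rw [← hm, ← hC₀, mul_pow, hpow]
    gcongr
    exact le_self_pow₀ hC1 (by omega)

theorem mainTheorem4 (n d : ℕ) (hd : 0 < d) (hdn : d < n) :
    ∃ CD C₀ δ₀ θ₀ : ℝ, 1 < CD ∧ 1 ≤ C₀ ∧ 0 < δ₀ ∧ 0 < θ₀ ∧ θ₀ < 1 ∧
      ∀ (δ : ℝ) (E : Set (EuclideanSpace ℝ (Fin n))), 0 < δ → δ < δ₀ → IsDeltaUR d δ E →
        (∃ CE : ℝ, IsAhlforsRegular d CE E) ∧
        (∃ C : ℝ, C ≤ CD ∧ Nonempty (DyadicSystem d E C)) ∧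
        ∀ (C : ℝ) (Δ : DyadicSystem d E C), C ≤ CD → Δ.AdmitsCorona (C₀ * δ ^ θ₀) := by
  obtain ⟨K, hK, hsys⟩ := exists_dyadicSystem hd (a := 8 ^ d) (one_le_pow₀ (by norm_num))
  obtain ⟨C₀, δ₀, θ₀, hC₀, hδ₀, hθ₀, hθ₁, hδd, hsmall⟩ := isSmallParam_rpow d hd hK.le
  refine ⟨K, C₀, δ₀, θ₀, hK, hC₀, hδ₀, hθ₀, hθ₁, fun δ E hδ hδlt hUR => ?_⟩
  have hE := hUR.isAhlforsRegular hd (hδlt.le.trans hδd)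
  exact ⟨⟨8 ^ d, hE⟩, ⟨K, le_rfl, hsys n E hE⟩, fun C Δ hC =>
    DyadicSystem.admitsCorona_of_isDeltaUR hC (hsmall δ hδ hδlt) hUR hE⟩
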